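/- **Theorem (Noise robustness).** Let $\mathbb T=\mathbb R/\mathbb Z$, let $\mathcal M(\mathbb T)$ be the space of real Radon measures on $\mathbb T$ (the dual of $C(\mathbb T)$) with the total variation norm $\|\cdot\|_{TV}$, let $\varphi\in C^2(\mathbb T,\mathbb R)$, and let $$\Phi:\mathcal M(\mathbb T)\to L^2(\mathbb T),\quad (\Phi m)(t)=\int_{\mathbb T}\varphi(x-t)\,dm(x),\qquad \Phi^*:L^2(\mathbb T)\to C(\mathbb T),\quad (\Phi^*p)(t)=\int_{\mathbb T}\varphi(t-x)p(x)\,dx .$$ For $z\in L^2(\mathbb T)$ let $\mathcal P_\lambda(z)$, $\lambda>0$, be the problem of minimizing $\frac12\|\Phi m-z\|_2^2+\lambda\|m\|_{TV}$ over $m\in\mathcal M(\mathbb T)$, and let $\mathcal P_0(z)$ be the problem of minimizing $\|m\|_{TV}$ subject to $\Phi m=z$. Let $m_0=\sum_{i=1}^N a_{0,i}\delta_{x_{0,i}}$ with all $a_{0,i}\in\mathbb R\setminus\{0\}$ and $x_{0,1},\dots,x_{0,N}\in\mathbb T$ distinct, and put $y=\Phi m_0$. Assume: 1. the map $\Gamma_{x_0}:\mathbb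 R^N\times\mathbb R^N\to L^2(\mathbb T)$, $(u,v)\mapsto\sum_{i=1}^N\big(u_i\,\varphi(x_{0,i}-\cdot)+v_i\,\varphi'(x_{0,i}-\cdot)\big)$, is injective; 2. $m_0$ satisfies the Non Degenerate Source Condition: there is $p\in L^2(\mathbb T)$ with $\Phi^*p\in\partial\|m_0\|_{TV}$, that is, $\|m\|_{TV}\ge\|m_0\|_{TV}+\int\Phi^*p\,d(m-m_0)$ for all $m\in\mathcal M(\mathbb T)$; and $\eta_0=\Phi^*p_0$, where $p_0$ is the solution of minimal $L^2$ norm of $\sup\{\langle y,p\rangle:\|\Phi^*p\|_\infty\le1\}$, satisfies $|\eta_0(s)|<1$ for all $s\in\mathbb T\setminus\{x_{0,1},\dots,x_{0,N}\}$ and $\eta_0''(x_{0,i})\ne0$ for $i=1,\dots,N$. Then there are $\alpha>0$ and $\lambda_0>0$ such that, with $D_{\alpha,\lambda_0}=\{(\lambda,w)\in\mathbb R\times L^2(\mathbb T): 0\le\lambda\le\lambda_0,\ \|w\|_2\le\alpha\lambda\}$, the following hold. * For every $(\lambda,w)\in D_{\alpha,\lambda_0}$ the problem $\mathcal P_\lambda(y+w)$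 has exactly one solution, and it is composed of exactly $N$ spikes: it equals $\sum_{i=1}^N\tilde a_i(\lambda,w)\,\delta_{\tilde x_i(\lambda,w)}$ with distinct positions, $\tilde a_i(\lambda,w)\neq0$ and $\operatorname{sign}\tilde a_i(\lambda,w)=\operatorname{sign}a_{0,i}$ for all $i$. Moreover $(\tilde a,\tilde x)(0,0)=(a_0,x_0)$. * For every integer $k\ge2$ such that $\varphi\in C^k(\mathbb T)$, the map $(\lambda,w)\in D_{\alpha,\lambda_0}\mapsto(\tilde a(\lambda,w),\tilde x(\lambda,w))\in\mathbb R^N\times\mathbb T^N$ is of class $C^{k-1}$, in the sense that it is the restriction of a $C^{k-1}$ map on an open neighbourhood of $D_{\alpha,\lambda_0}$ in $\mathbb R\times L^2(\mathbb T)$. * There is a constant $C$ such that for every $w\in L^2(\mathbb T)$ with $\|w\|_2\le\alpha\lambda_0$, taking $\lambda=\|w\|_2/\alpha$, one has $|\tilde x_i(\lambda,w)-x_{0,i}|\le C\|w\|_2$ (distance on $\mathbb T$) and $|\tilde a_i(\lambda,w)-a_{0,i}|\le C\|w\|_2$ for all $i$. -/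

import Mathlib

open MeasureTheory Filter Topology

noncomputable section

namespace SpikeDeconv

/-- The torus `𝕋 = ℝ/ℤ`, with its Lebesgue (Haar) measure `volume` of total mass one. -/
abbrev Torus : Type := UnitAddCircle

/-- The real Hilbert space `L²(𝕋)`. -/
abbrev L2 : Type := Lp ℝ 2 (volume : Measure Torus)

/-- The real Radon measures on `𝕋`, as the dual of `C(𝕋)`. The dual norm `‖m‖` is the
total variation of `m`, and `∫ ψ dm` is written `m ψ`. -/
abbrev Radon : Type := C(Torus, ℝ) →L[ℝ] ℝ

/-- The discrete measure `m_{a,x} = ∑ i, a i • δ_{x i}`. -/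
def discreteMeasure {N : ℕ} (a : Fin N → ℝ) (x : Fin N → Torus) : Radon :=
  ∑ i, a i • ContinuousMap.evalCLM ℝ (x i)

/-- `f : 𝕋 → ℝ` is of class `C^n`: its `1`-periodic lift to `ℝ` is. -/
def IsC (n : WithTop ℕ∞) (f : Torus → ℝ) : Prop :=
  ContDiff ℝ n (fun s : ℝ => f (s : Torus))

/-- The derivative of a function on the torus. -/
def torusDeriv (f : Torus → ℝ) (t : Torus) : ℝ :=
  deriv (fun s : ℝ => f (t + (s : Torus))) 0

theorem continuous_torusDeriv {f : Torus → ℝ} (hf : IsC 1 f) : Continuous (torusDeriv f) := by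
  have h : Continuous (fun s : ℝ => torusDeriv f (s : Torus)) := by
    have e : (fun s : ℝ => torusDeriv f (s : Torus)) =
        deriv (fun s : ℝ => f (s : Torus)) := by
      funext s
      have := deriv_comp_const_add (fun r : ℝ => f (r : Torus)) s 0
      simpa [torusDeriv] using this
    rw [e]
    exact hf.continuous_deriv le_rfl
  exact continuous_coinduced_dom.2 h

/-- The derivative `φ'`, as a continuous function, of a function `φ` of class `C²`. -/
def derivC (φ : C(Torus, ℝ)) (hφ : IsC 2 φ) : C(Torus, ℝ) :=
  ⟨torusDeriv φ, continuous_torusDeriv (ContDiff.of_le hφ (by norm_num))⟩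

/-- The continuous map `t ↦ φ(· - t)` from `𝕋` to `C(𝕋)`. -/
def shift (φ : C(Torus, ℝ)) : C(Torus, C(Torus, ℝ)) :=
  ContinuousMap.curry ⟨fun q : Torus × Torus => φ (q.2 - q.1), by fun_prop⟩

/-- The operator `Φ : M(𝕋) → L²(𝕋)` with kernel `φ`, `(Φ m)(t) = ∫ φ(x - t) dm(x)`. -/
def Phi (φ : C(Torus, ℝ)) (m : Radon) : L2 :=
  ContinuousMap.toLp 2 volume ℝ ⟨fun t => m (shift φ t), by fun_prop⟩

theorem continuous_conv (φ : C(Torus, ℝ)) (p : L2) :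
    Continuous fun t : Torus => ∫ x, φ (t - x) * p x := by
  have hp : Integrable (p : Torus → ℝ) volume :=
    (Lp.memLp p).integrable (by norm_num)
  refine continuous_of_dominated (bound := fun x => ‖φ‖ * ‖p x‖) ?_ ?_ ?_ ?_
  · intro t
    exact (by fun_prop : Continuous fun x : Torus => φ (t - x)).aestronglyMeasurable.mul
      hp.aestronglyMeasurable
  · intro t
    filter_upwards with x
    rw [norm_mul]
    gcongr
    exact φ.norm_coe_le_norm _
  · exact hp.norm.const_mul _
  · filter_upwards with x
    fun_prop

/-- The adjoint `Φ* : L²(𝕋) → C(𝕋)`, `(Φ* p)(t) = ∫ φ(t - x) p(x) dx`. -/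
def PhiAdj (φ : C(Torus, ℝ)) (p : L2) : C(Torus, ℝ) :=
  ⟨fun t => ∫ x, φ (t - x) * p x, continuous_conv φ p⟩

/-- `Γ_x (u, v) = Φ_x u + Φ'_x v = ∑ i, (u i • φ(x i - ·) + v i • φ'(x i - ·)) ∈ L²(𝕋)`. -/
def Gam (φ : C(Torus, ℝ)) (hφ : IsC 2 φ) {N : ℕ} (x : Fin N → Torus)
    (q : (Fin N → ℝ) × (Fin N → ℝ)) : L2 :=
  Phi φ (discreteMeasure q.1 x) + Phi (derivC φ hφ) (discreteMeasure q.2 x)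

/-- The subdifferential of the total variation at `m`. -/
def subdiffTV (m : Radon) : Set C(Torus, ℝ) :=
  {η | ∀ m' : Radon, ‖m‖ + (m' - m) η ≤ ‖m'‖}

/-- `m` solves `P_lam(z)`: for `lam ≠ 0`, minimize `½‖Φ m - z‖² + lam ‖m‖` over all measures;
for `lam = 0`, minimize `‖m‖` subject to `Φ m = z`. -/
def IsPrimalSolution (φ : C(Torus, ℝ)) (lam : ℝ) (z : L2) (m : Radon) : Prop :=
  (lam ≠ 0 → ∀ m' : Radon,
    1 / 2 * ‖Phi φ m - z‖ ^ 2 + lam * ‖m‖ ≤ 1 / 2 * ‖Phi φ m' - z‖ ^ 2 + lam * ‖m'‖) ∧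
  (lam = 0 → Phi φ m = z ∧ ∀ m' : Radon, Phi φ m' = z → ‖m‖ ≤ ‖m'‖)

/-- `p` solves `D_0(y)`: maximize `⟪y, p⟫` subject to `‖Φ* p‖_∞ ≤ 1`. -/
def IsDualSolution (φ : C(Torus, ℝ)) (y p : L2) : Prop :=
  ‖PhiAdj φ p‖ ≤ 1 ∧ ∀ q : L2, ‖PhiAdj φ q‖ ≤ 1 → inner ℝ y q ≤ inner ℝ y p

/-- `p` is the solution of `D_0(y)` of minimal norm. -/
def IsMinNormDualSolution (φ : C(Torus, ℝ)) (y p : L2) : Prop :=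
  IsDualSolution φ y p ∧ ∀ q : L2, IsDualSolution φ y q → ‖p‖ ≤ ‖q‖

/-- The Non Degenerate Source Condition for `m_{a,x}` (with `a i ≠ 0` and distinct `x i`). -/
def NDSC (φ : C(Torus, ℝ)) {N : ℕ} (a : Fin N → ℝ) (x : Fin N → Torus) : Prop :=
  (∃ p : L2, PhiAdj φ p ∈ subdiffTV (discreteMeasure a x)) ∧
  ∃ p₀ : L2, IsMinNormDualSolution φ (Phi φ (discreteMeasure a x)) p₀ ∧
    (∀ s : Torus, s ∉ Set.range x → |PhiAdj φ p₀ s| < 1) ∧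
    ∀ i, torusDeriv (torusDeriv (PhiAdj φ p₀)) (x i) ≠ 0

/-- The small noise domain `D_{α,lam0}`. -/
def smallNoise (α lam0 : ℝ) : Set (ℝ × L2) :=
  {q | 0 ≤ q.1 ∧ q.1 ≤ lam0 ∧ ‖q.2‖ ≤ α * q.1}

/-- A map `g` into `𝕋^N` is of class `C^n` on `U`: near each point of `U` it is the projection of
an `ℝ^N`-valued map of class `C^n`. -/
def TorusContDiffOn {E : Type*} [NormedAddCommGroup E] [NormedSpace ℝ E] {N : ℕ}
    (n : WithTop ℕ∞) (g : E → Fin N → Torus) (U : Set E) : Prop :=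
  ∀ q ∈ U, ∃ X : E → Fin N → ℝ, ContDiffWithinAt ℝ n X U q ∧
    ∀ᶠ r in 𝓝[U] q, ∀ i, g r i = ((X r i : ℝ) : Torus)

end SpikeDeconv

end

open SpikeDeconv

namespace SpikeDeconv

/-! ### The pairing between `Φ` and `Φ*` -/

/-! Lift positions to reals and put ψ(s) = φ(s - ·), a curve in L². A measure with amplitudes a and
positions X solves the problem for λ > 0 as soon as p = (y + w - Φm)/λ is a certificate: Φ*p equals
sign a_i at X_i and has modulus below 1 elsewhere. It is then the only solution if the ψ(X_i) are
independent, because every solution attains its norm at Φ*p and so lives on the X_i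
(`primalSolution_unique_pos`).

Interpolation of the signs s with vanishing derivatives gives 2N equations in the 2N unknowns (a,
X). Multiplied by λ, they make sense and stay smooth at λ = 0 (`optimalitySystem`). At the origin
the residual vanishes, so the partial derivative in (a, X) is Γ*Γ times the invertible diagonal map
(1, a₀). The implicit function theorem gives a branch of class C^{k-1}, one derivative being lost
because the system contains ψ'.

It remains to see that the branch produces certificates. Let T be the span of the ψ(X₀ᵢ) and
ψ'(X₀ᵢ). Nondegeneracy is stable under small perturbations (`eventually_certificate`), so p₀ plus a
small vector orthogonal to T is still a dual solution; minimality of the norm forces p₀ ∈ T. Hence,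
to first order, the residual plus λp₀ is minus the projection of w on the orthogonal of T
(`eventually_norm_residual_add_le`). Dividing by λ, p stays close to p₀ when ‖w‖/λ is small, and
stability applies again. -/

theorem inner_Phi (φ : C(Torus, ℝ)) (m : Radon) (p : L2) :
    inner ℝ (Phi φ m) p = m (PhiAdj φ p) := by
  have hp : Integrable (p : Torus → ℝ) volume := (Lp.memLp p).integrable (by norm_num)
  have hint : Integrable (fun t => p t • shift φ t) volume := by
    refine (hp.norm.mul_const ‖shift φ‖).mono'
      (hp.aestronglyMeasurable.smul (shift φ).continuous.aestronglyMeasurable) ?_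
    filter_upwards with t
    rw [norm_smul]
    gcongr
    exact (shift φ).norm_coe_le_norm t
  -- Once `PhiAdj φ p` is a Bochner integral in `C(𝕋)`, the functional `m` passes under the integral
  -- sign; this plays the role of Fubini.
  have hadj : PhiAdj φ p = ∫ t, p t • shift φ t := by
    ext x
    have h := (ContinuousMap.evalCLM ℝ x : Radon).integral_comp_comm hint
    rw [ContinuousMap.evalCLM_apply] at h
    rw [← h]
    refine integral_congr_ae (Eventually.of_forall fun t => ?_)
    simp [shift, mul_comm]
  rw [hadj, ← m.integral_comp_comm hint, L2.inner_def]
  refine integral_congr_ae ?_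
  filter_upwards [ContinuousMap.coeFn_toLp (p := 2) (𝕜 := ℝ) (volume : Measure Torus)
    ⟨fun t => m (shift φ t), by fun_prop⟩] with t ht
  rw [Phi, ht]
  simp

/-! ### The feature map -/

/-- The continuous map `s ↦ φ(s - ·)` from `𝕋` to `C(𝕋)`. -/
noncomputable def reflect (φ : C(Torus, ℝ)) : C(Torus, C(Torus, ℝ)) :=
  ContinuousMap.curry ⟨fun q : Torus × Torus => φ (q.1 - q.2), by fun_prop⟩

/-- The feature map `s ↦ φ(s - ·)`, as a curve in `L²(𝕋)`. -/
noncomputable def feature (φ : C(Torus, ℝ)) (s : ℝ) : L2 :=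
  ContinuousMap.toLp 2 volume ℝ (reflect φ s)

theorem Phi_evalCLM (φ : C(Torus, ℝ)) (s : ℝ) :
    Phi φ (ContinuousMap.evalCLM ℝ (s : Torus)) = feature φ s := by
  rfl

theorem Phi_discreteMeasure (φ : C(Torus, ℝ)) {N : ℕ} (a : Fin N → ℝ) (X : Fin N → ℝ) :
    Phi φ (discreteMeasure a fun i => (X i : Torus)) = ∑ i, a i • feature φ (X i) :=
  ext_inner_right ℝ fun p => by
    simp [inner_Phi, discreteMeasure, sum_inner, inner_smul_left, ← Phi_evalCLM]

theorem inner_feature (φ : C(Torus, ℝ)) (p : L2) (s : ℝ) :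
    inner ℝ (feature φ s) p = PhiAdj φ p (s : Torus) := by
  rw [← Phi_evalCLM, inner_Phi]; rfl

theorem torusDeriv_coe (f : Torus → ℝ) (s : ℝ) :
    torusDeriv f (s : Torus) = deriv (fun s : ℝ => f (s : Torus)) s := by
  have := deriv_comp_const_add (fun r : ℝ => f (r : Torus)) s 0
  simpa [torusDeriv] using this

theorem hasDerivAt_feature {φ : C(Torus, ℝ)} (hφ : IsC 1 φ) (s : ℝ) :
    HasDerivAt (feature φ) (feature ⟨torusDeriv φ, continuous_torusDeriv hφ⟩ s) s := by
  set φ' : C(Torus, ℝ) := ⟨torusDeriv φ, continuous_torusDeriv hφ⟩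
  have hcont : Continuous fun r : ℝ => reflect φ' (r : Torus) :=
    (reflect φ').continuous.comp (AddCircle.continuous_mk' 1)
  have hφd : ∀ r : ℝ, HasDerivAt (fun r : ℝ => φ (r : Torus)) (φ' (r : Torus)) r := fun r => by
    have := (hφ.differentiable one_ne_zero r).hasDerivAt
    rwa [← torusDeriv_coe] at this
  -- Writing the curve as a primitive in `C(𝕋)` turns pointwise differentiability of `φ` into
  -- differentiability for the sup norm, hence in L².
  have hftc : ∀ u : ℝ, reflect φ (u : Torus) =
      reflect φ ((0 : ℝ) : Torus) + ∫ r in (0 : ℝ)..u, reflect φ' (r : Torus) := by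
    intro u
    ext t
    obtain ⟨t, rfl⟩ := QuotientAddGroup.mk_surjective t
    have h := (ContinuousMap.evalCLM ℝ (t : Torus) : Radon).intervalIntegral_comp_comm
      (hcont.intervalIntegrable (μ := volume) 0 u)
    rw [ContinuousMap.evalCLM_apply] at h
    rw [ContinuousMap.add_apply, ← h]
    have hd : ∀ r ∈ Set.uIcc 0 u, HasDerivAt (fun r : ℝ => φ ((r - t : ℝ) : Torus))
        (φ' ((r - t : ℝ) : Torus)) r := fun r _ => (hφd (r - t)).comp_sub_const r t
    have hi := intervalIntegral.integral_eq_sub_of_hasDerivAt hd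
      (Continuous.intervalIntegrable (by fun_prop) _ _)
    have e : ∀ r : ℝ, (ContinuousMap.evalCLM ℝ (t : Torus) : Radon) (reflect φ' (r : Torus)) =
        φ' ((r - t : ℝ) : Torus) := fun r => rfl
    simp only [e]
    rw [hi]
    change φ ((u - t : ℝ) : Torus) = φ ((0 - t : ℝ) : Torus) + _
    ring
  have hmain : HasDerivAt (fun u : ℝ => reflect φ (u : Torus)) (reflect φ' (s : Torus)) s := by
    rw [funext hftc]
    exact (intervalIntegral.integral_hasDerivAt_right (hcont.intervalIntegrable 0 s)
      (hcont.stronglyMeasurableAtFilter _ _) hcont.continuousAt).const_add _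
  exact (ContinuousMap.toLp 2 volume ℝ : C(Torus, ℝ) →L[ℝ] L2).hasFDerivAt.comp_hasDerivAt s hmain

theorem deriv_feature {φ : C(Torus, ℝ)} (hφ : IsC 1 φ) :
    deriv (feature φ) = feature ⟨torusDeriv φ, continuous_torusDeriv hφ⟩ :=
  funext fun s => (hasDerivAt_feature hφ s).deriv

theorem contDiff_feature {n : ℕ} : ∀ {φ : C(Torus, ℝ)}, IsC n φ → ContDiff ℝ n (feature φ) := by
  induction n with
  | zero =>
    intro φ _
    exact contDiff_zero.2 ((ContinuousMap.toLp 2 volume ℝ : C(Torus, ℝ) →L[ℝ] L2).continuous.comp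
      ((reflect φ).continuous.comp (AddCircle.continuous_mk' 1)))
  | succ n ih =>
    intro φ hφ
    have h1 : IsC 1 φ := ContDiff.of_le hφ (by simp)
    push_cast
    refine contDiff_succ_iff_deriv.2
      ⟨fun s => (hasDerivAt_feature h1 s).differentiableAt, by simp, ?_⟩
    rw [deriv_feature h1]
    refine ih ?_
    have h := (contDiff_succ_iff_deriv.1 (by exact_mod_cast hφ : ContDiff ℝ ((n : WithTop ℕ∞) + 1)
      fun s : ℝ => φ (s : Torus))).2.2
    rwa [← funext (torusDeriv_coe φ)] at h

theorem Phi_derivC_discreteMeasure (φ : C(Torus, ℝ)) (hφ : IsC 2 φ) {N : ℕ} (a : Fin N → ℝ)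
    (X : Fin N → ℝ) : Phi (derivC φ hφ) (discreteMeasure a fun i => (X i : Torus)) =
      ∑ i, a i • deriv (feature φ) (X i) := by
  rw [Phi_discreteMeasure, deriv_feature (ContDiff.of_le hφ (by norm_num))]; rfl

theorem torusDeriv_torusDeriv_PhiAdj {φ : C(Torus, ℝ)} (hφ : IsC 2 φ) (p : L2) (s : ℝ) :
    torusDeriv (torusDeriv (PhiAdj φ p)) (s : Torus) =
      inner ℝ (deriv (deriv (feature φ)) s) p := by
  have hψ : ContDiff ℝ 2 (feature φ) := contDiff_feature (n := 2) hφ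
  have hψ' : ContDiff ℝ 1 (deriv (feature φ)) :=
    (contDiff_succ_iff_deriv.1 (by simpa [one_add_one_eq_two] using hψ)).2.2
  have key : ∀ g : ℝ → L2, Differentiable ℝ g →
      deriv (fun s => inner ℝ (g s) p) = fun s => inner ℝ (deriv g s) p := fun g hg => by
    ext s
    simpa using ((hg s).hasDerivAt.inner ℝ (hasDerivAt_const s p)).deriv
  have h1 : (fun s : ℝ => torusDeriv (PhiAdj φ p) (s : Torus)) =
      fun s => inner ℝ (deriv (feature φ) s) p := by
    rw [← key _ (hψ.differentiable (by norm_num))]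
    ext s
    rw [torusDeriv_coe]
    simp only [inner_feature]
  rw [torusDeriv_coe, h1, key _ (hψ'.differentiable (by norm_num))]

/-! ### Discrete measures and the total variation norm -/

theorem apply_le_norm (m : Radon) {η : C(Torus, ℝ)} (hη : ‖η‖ ≤ 1) : m η ≤ ‖m‖ :=
  (le_abs_self _).trans (m.le_of_opNorm_le_of_le le_rfl hη |>.trans_eq (mul_one _))

theorem norm_evalCLM_le (t : Torus) : ‖(ContinuousMap.evalCLM ℝ t : Radon)‖ ≤ 1 :=
  ContinuousLinearMap.opNorm_le_bound _ zero_le_one fun f => by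
    rw [one_mul]; exact f.norm_coe_le_norm t

theorem discreteMeasure_apply {N : ℕ} (a : Fin N → ℝ) (x : Fin N → Torus) (f : C(Torus, ℝ)) :
    discreteMeasure a x f = ∑ i, a i * f (x i) := by
  simp [discreteMeasure]

theorem norm_discreteMeasure_le {N : ℕ} (a : Fin N → ℝ) (x : Fin N → Torus) :
    ‖discreteMeasure a x‖ ≤ ∑ i, |a i| := by
  refine (norm_sum_le (E := Radon) _ _).trans (Finset.sum_le_sum fun i _ => ?_)
  exact (ContinuousLinearMap.opNorm_smul_le _ _).trans
    (mul_le_of_le_one_right (norm_nonneg _) (norm_evalCLM_le _))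

/-- Since the points are distinct, Tietze's theorem extends the signs of the amplitudes to a
function in the unit ball of `C(𝕋)`. -/
theorem norm_discreteMeasure {N : ℕ} (a : Fin N → ℝ) {x : Fin N → Torus}
    (hx : Function.Injective x) : ‖discreteMeasure a x‖ = ∑ i, |a i| := by
  refine (norm_discreteMeasure_le a x).antisymm ?_
  have he : IsClosedEmbedding x := .of_continuous_injective_isClosedMap
    continuous_of_discreteTopology hx fun s _ => (s.toFinite.image x).isClosed
  obtain ⟨g, hg, hgx⟩ := ContinuousMap.exists_extension_forall_mem_of_isClosedEmbedding
    (⟨fun i => (SignType.sign (a i) : ℝ), continuous_of_discreteTopology⟩ : C(Fin N, ℝ))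
    (t := Set.Icc (-1) 1) (fun i => by
      rcases lt_trichotomy (a i) 0 with h | h | h <;> simp [h]) ⟨0, by simp⟩ he
  have hg1 : ‖g‖ ≤ 1 := (ContinuousMap.norm_le _ zero_le_one).2 fun t => abs_le.2 (hg t)
  refine le_trans (le_of_eq ?_) (apply_le_norm _ hg1)
  rw [discreteMeasure_apply]
  refine Finset.sum_congr rfl fun i _ => ?_
  have h := congrFun hgx i
  simp only [Function.comp_apply, ContinuousMap.coe_mk] at h
  rw [h, self_mul_sign]

/-- Test the subgradient inequality on `m ± δ_t`, whose norm exceeds `‖m‖` by at most 1. -/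
theorem norm_le_one_of_mem_subdiffTV {m : Radon} {η : C(Torus, ℝ)} (h : η ∈ subdiffTV m) :
    ‖η‖ ≤ 1 := by
  refine (ContinuousMap.norm_le _ zero_le_one).2 fun t => abs_le.2 ⟨?_, ?_⟩
  · have h1 := h (m - ContinuousMap.evalCLM ℝ t)
    have h2 := norm_sub_le m (ContinuousMap.evalCLM ℝ t)
    have h3 := norm_evalCLM_le t
    simp at h1
    linarith
  · have h1 := h (m + ContinuousMap.evalCLM ℝ t)
    have h2 := norm_add_le m (ContinuousMap.evalCLM ℝ t)
    have h3 := norm_evalCLM_le t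
    simp at h1
    linarith

theorem norm_le_apply_of_mem_subdiffTV {m : Radon} {η : C(Torus, ℝ)} (h : η ∈ subdiffTV m) :
    ‖m‖ ≤ m η := by
  have h1 := h 0
  rw [norm_zero (E := Radon)] at h1
  simp at h1
  linarith

/-- A measure which attains its norm at `η` does not see what is away from `{|η| = 1}`. -/
theorem apply_eq_zero_of_norm_attained {m : Radon} {η : C(Torus, ℝ)} (hm : m η = ‖m‖)
    (hη : ‖η‖ ≤ 1) {f : C(Torus, ℝ)} (hf : ∀ t, f t ≠ 0 → |η t| < 1) : m f = 0 := by
  -- Where `g` lives, compactness leaves a margin `κ` below 1 for `|η|`. So `η + c • g` stays in the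
  -- unit ball for small `c` of either sign, and maximality of `m η` forces `m g = 0`.
  have hsupp : ∀ δ > 0, ∀ g : C(Torus, ℝ), (∀ t, g t ≠ 0 → δ ≤ |f t|) → m g = 0 := by
    intro δ hδ g hg
    have hK : IsCompact {t | δ ≤ |f t|} :=
      (isClosed_le continuous_const (by fun_prop)).isCompact
    obtain ⟨κ, hκ, hκ'⟩ : ∃ κ > 0, ∀ t, δ ≤ |f t| → |η t| ≤ 1 - κ := by
      rcases Set.eq_empty_or_nonempty {t | δ ≤ |f t|} with h | h
      · exact ⟨1, one_pos, fun t ht => absurd ht (Set.eq_empty_iff_forall_notMem.1 h t)⟩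
      · obtain ⟨t₀, ht₀, hmax⟩ := hK.exists_isMaxOn h
          (by fun_prop : Continuous fun t => |η t|).continuousOn
        refine ⟨1 - |η t₀|, ?_, fun t ht => ?_⟩
        · have := hf t₀ (abs_pos.1 (hδ.trans_le ht₀))
          linarith
        · have : |η t| ≤ |η t₀| := hmax ht
          linarith
    have key : ∀ c : ℝ, |c| * ‖g‖ ≤ κ → c * m g ≤ 0 := by
      intro c hc
      have h1 : ‖η + c • g‖ ≤ 1 := by
        refine (ContinuousMap.norm_le _ zero_le_one).2 fun t => ?_
        rcases eq_or_ne (g t) 0 with h | h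
        · simpa [h] using (η.norm_coe_le_norm t).trans hη
        · have h2 := hκ' t (hg t h)
          have h3 : |c * g t| ≤ κ := by
            rw [abs_mul]
            exact (mul_le_mul_of_nonneg_left (g.norm_coe_le_norm t) (abs_nonneg c)).trans hc
          have h4 := abs_add_le (η t) (c * g t)
          simp only [ContinuousMap.add_apply, ContinuousMap.smul_apply, smul_eq_mul,
            Real.norm_eq_abs]
          linarith
      have h2 := apply_le_norm m h1
      simp only [map_add, map_smul, smul_eq_mul] at h2
      linarith
    have hc : 0 < κ / (‖g‖ + 1) := by positivity
    have hb : κ / (‖g‖ + 1) * ‖g‖ ≤ κ := by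
      rw [div_mul_eq_mul_div, div_le_iff₀ (by positivity)]
      nlinarith [norm_nonneg g]
    have h1 := key (κ / (‖g‖ + 1)) (by rwa [abs_of_pos hc])
    have h2 := key (-(κ / (‖g‖ + 1))) (by rwa [abs_neg, abs_of_pos hc])
    nlinarith
  by_contra hne
  have hpos : 0 < |m f| := abs_pos.2 hne
  -- Chosen so that `‖m‖ * δ` is less than `|m f|`. The soft thresholding `g` of `f` at level `δ` is
  -- killed by `m` and is within `δ` of `f`, a contradiction.
  set δ := |m f| / (2 * (‖m‖ + 1)) with hδdef
  have hδ : 0 < δ := by positivity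
  let g : C(Torus, ℝ) := ⟨fun t => max (f t - δ) 0 - max (-f t - δ) 0, by fun_prop⟩
  have hgdef : ∀ t, g t = max (f t - δ) 0 - max (-f t - δ) 0 := fun t => rfl
  have hg0 : m g = 0 := by
    refine hsupp δ hδ g fun t ht => ?_
    by_contra! h
    rw [abs_lt] at h
    refine ht ?_
    rw [hgdef, max_eq_right (by linarith), max_eq_right (by linarith), sub_zero]
  have hfg : ‖f - g‖ ≤ δ := by
    refine (ContinuousMap.norm_le _ hδ.le).2 fun t => ?_
    rw [ContinuousMap.sub_apply, hgdef, Real.norm_eq_abs, abs_le]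
    rcases max_cases (f t - δ) 0 with ⟨h1, h2⟩ | ⟨h1, h2⟩ <;>
    rcases max_cases (-f t - δ) 0 with ⟨h3, h4⟩ | ⟨h3, h4⟩ <;>
    rw [h1, h3] <;> constructor <;> linarith
  have h1 : |m f| ≤ ‖m‖ * δ := by
    have := m.le_of_opNorm_le_of_le le_rfl hfg
    rwa [map_sub, hg0, sub_zero] at this
  have h2 : δ * (2 * (‖m‖ + 1)) = |m f| := by
    rw [hδdef]
    field_simp
  nlinarith [norm_nonneg m]

/-- A linear form vanishing on the common kernel of finitely many evaluations is a combination of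
them. -/
theorem exists_eq_discreteMeasure {m : Radon} {η : C(Torus, ℝ)} (hm : m η = ‖m‖)
    (hη : ‖η‖ ≤ 1) {N : ℕ} {x : Fin N → Torus} (hx : ∀ t, t ∉ Set.range x → |η t| < 1) :
    ∃ b, m = discreteMeasure b x := by
  have h : (m : C(Torus, ℝ) →ₗ[ℝ] ℝ) ∈ Submodule.span ℝ (Set.range fun i =>
      ((ContinuousMap.evalCLM ℝ (x i) : Radon) : C(Torus, ℝ) →ₗ[ℝ] ℝ)) := by
    refine mem_span_of_iInf_ker_le_ker fun f hf => ?_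
    simp only [Submodule.mem_iInf, LinearMap.mem_ker] at hf
    refine apply_eq_zero_of_norm_attained hm hη fun t ht => hx t ?_
    rintro ⟨i, rfl⟩
    exact ht (hf i)
  obtain ⟨b, hb⟩ := (Submodule.mem_span_range_iff_exists_fun ℝ).1 h
  refine ⟨b, ?_⟩
  ext f
  have := congrArg (fun L : C(Torus, ℝ) →ₗ[ℝ] ℝ => L f) hb
  simp only [ContinuousLinearMap.coe_coe] at this
  rw [← this]
  simp [discreteMeasure]

/-! ### Uniqueness from a dual certificate -/

section Certificate

variable {φ : C(Torus, ℝ)} {N : ℕ} {a : Fin N → ℝ} {x : Fin N → Torus} {p : L2}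

theorem norm_discreteMeasure_eq_of_certificate (hp : ‖PhiAdj φ p‖ ≤ 1)
    (ha : ∀ i, a i * PhiAdj φ p (x i) = |a i|) :
    discreteMeasure a x (PhiAdj φ p) = ‖discreteMeasure a x‖ := by
  refine (apply_le_norm _ hp).antisymm ((norm_discreteMeasure_le a x).trans_eq ?_)
  rw [discreteMeasure_apply]
  exact (Finset.sum_congr rfl fun i _ => ha i).symm

theorem eq_discreteMeasure_of_certificate (hp : ‖PhiAdj φ p‖ ≤ 1)
    (hoff : ∀ t, t ∉ Set.range x → |PhiAdj φ p t| < 1)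
    (hinj : Function.Injective fun b => Phi φ (discreteMeasure b x)) {m : Radon}
    (hm : m (PhiAdj φ p) = ‖m‖) (hΦ : Phi φ m = Phi φ (discreteMeasure a x)) :
    m = discreteMeasure a x := by
  obtain ⟨b, rfl⟩ := exists_eq_discreteMeasure hm hp hoff
  rw [hinj hΦ]

theorem primalSolution_unique_zero (hp : ‖PhiAdj φ p‖ ≤ 1)
    (hoff : ∀ t, t ∉ Set.range x → |PhiAdj φ p t| < 1)
    (ha : ∀ i, a i * PhiAdj φ p (x i) = |a i|)
    (hinj : Function.Injective fun b => Phi φ (discreteMeasure b x)) :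
    {m | IsPrimalSolution φ 0 (Phi φ (discreteMeasure a x)) m} = {discreteMeasure a x} := by
  have hm₀ := norm_discreteMeasure_eq_of_certificate hp ha
  have key : ∀ m, Phi φ m = Phi φ (discreteMeasure a x) →
      m (PhiAdj φ p) = ‖discreteMeasure a x‖ := fun m hm => by
    rw [← hm₀, ← inner_Phi, ← inner_Phi, hm]
  ext m
  simp only [Set.mem_ofPred_eq, Set.mem_singleton_iff]
  constructor
  · rintro ⟨-, h⟩
    obtain ⟨h1, h2⟩ := h rfl
    refine eq_discreteMeasure_of_certificate hp hoff hinj ?_ h1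
    exact (apply_le_norm m hp).antisymm ((h2 _ rfl).trans_eq (key m h1).symm)
  · rintro rfl
    exact ⟨fun h => absurd rfl h, fun _ => ⟨rfl, fun m' hm' =>
      (key m' hm').symm.trans_le (apply_le_norm m' hp)⟩⟩

theorem primalSolution_unique_pos {lam : ℝ} (hlam : 0 < lam) {z : L2}
    (hz : lam • p = z - Phi φ (discreteMeasure a x)) (hp : ‖PhiAdj φ p‖ ≤ 1)
    (hoff : ∀ t, t ∉ Set.range x → |PhiAdj φ p t| < 1)
    (ha : ∀ i, a i * PhiAdj φ p (x i) = |a i|)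
    (hinj : Function.Injective fun b => Phi φ (discreteMeasure b x)) :
    {m | IsPrimalSolution φ lam z m} = {discreteMeasure a x} := by
  have hm₀ := norm_discreteMeasure_eq_of_certificate hp ha
  set m₀ := discreteMeasure a x
  -- With this identity, the objective at `m` minus that at `m₀` is `½‖Φ m - Φ m₀‖² + lam (‖m‖ - m
  -- (Φ* p))`, a sum of two nonnegative terms. Both vanish at a minimizer.
  have key : ∀ m, 1 / 2 * ‖Phi φ m - z‖ ^ 2 = 1 / 2 * ‖Phi φ m₀ - z‖ ^ 2
      + 1 / 2 * ‖Phi φ m - Phi φ m₀‖ ^ 2 - lam * (m (PhiAdj φ p) - ‖m₀‖) := by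
    intro m
    have e : Phi φ m - z = (Phi φ m - Phi φ m₀) - lam • p := by rw [hz]; abel
    have e' : Phi φ m₀ - z = -(lam • p) := by rw [hz]; abel
    rw [e, e', norm_sub_sq_real, norm_neg, inner_smul_right, inner_sub_left, inner_Phi,
      inner_Phi, hm₀]
    ring
  ext m
  simp only [Set.mem_ofPred_eq, Set.mem_singleton_iff]
  constructor
  · rintro ⟨h, -⟩
    have h1 := h hlam.ne' m₀
    rw [key m] at h1
    have h2 := apply_le_norm m hp
    have h3 : lam * m (PhiAdj φ p) ≤ lam * ‖m‖ := mul_le_mul_of_nonneg_left h2 hlam.le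
    have h4 := sq_nonneg ‖Phi φ m - Phi φ m₀‖
    refine eq_discreteMeasure_of_certificate hp hoff hinj (h2.antisymm ?_) ?_
    · refine le_of_mul_le_mul_left (a := lam) ?_ hlam
      linarith
    · have h5 : ‖Phi φ m - Phi φ m₀‖ ^ 2 = 0 := by linarith
      exact sub_eq_zero.1 (norm_eq_zero.1 (pow_eq_zero_iff two_ne_zero |>.1 h5))
  · rintro rfl
    refine ⟨fun _ m' => ?_, fun h => absurd h hlam.ne'⟩
    rw [key m']
    have h3 : lam * m' (PhiAdj φ p) ≤ lam * ‖m'‖ :=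
      mul_le_mul_of_nonneg_left (apply_le_norm m' hp) hlam.le
    have h4 := sq_nonneg ‖Phi φ m' - Phi φ m₀‖
    linarith

end Certificate

/-! ### An implicit function theorem with a domain independent of the regularity -/

/-- The inverse function theorem applied to `(v, u) ↦ (v, F (v, u))`. A single `U` must serve every
regularity `n`, so it is cut out by invertibility of the derivative, a condition that does not
involve `n`. Injectivity in `u` suffices because `W` is finite dimensional. -/
theorem exists_implicitFunction {E W : Type*} [NormedAddCommGroup E] [NormedSpace ℝ E]
    [CompleteSpace E] [NormedAddCommGroup W] [NormedSpace ℝ W] [FiniteDimensional ℝ W]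
    {F : E × W → W} (hF : ContDiff ℝ 1 F) {v₀ : E} {u₀ : W} (h₀ : F (v₀, u₀) = 0)
    (hinj : ∀ du, fderiv ℝ F (v₀, u₀) (0, du) = 0 → du = 0) :
    ∃ U : Set E, IsOpen U ∧ v₀ ∈ U ∧ ∃ u : E → W, u v₀ = u₀ ∧ (∀ v ∈ U, F (v, u v) = 0) ∧
      ∀ n : WithTop ℕ∞, ContDiff ℝ n F → ContDiffOn ℝ n u U := by
  have : CompleteSpace W := FiniteDimensional.complete ℝ W
  let G : E × W → E × W := fun z => (z.1, F z)
  have hGn : ∀ n : WithTop ℕ∞, ContDiff ℝ n F → ContDiff ℝ n G := fun n h =>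
    contDiff_fst.prodMk h
  have hG := hGn 1 hF
  set G' : E × W →L[ℝ] E × W := fderiv ℝ G (v₀, u₀) with hG'
  set F' := fderiv ℝ F (v₀, u₀) with hF'
  have hG'eq : G' = (ContinuousLinearMap.fst ℝ E W).prod F' :=
    (hasFDerivAt_fst.prodMk (hF.differentiable one_ne_zero _).hasFDerivAt).fderiv
  have hsurj : ∀ b : W, ∃ du, F' (0, du) = b := by
    let L : W →ₗ[ℝ] W := F'.toLinearMap ∘ₗ LinearMap.inr ℝ E W
    have hL : Function.Injective L := (injective_iff_map_eq_zero L).2 hinj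
    exact LinearMap.injective_iff_surjective.1 hL
  have hker : (G' : E × W →ₗ[ℝ] E × W).ker = ⊥ := by
    refine LinearMap.ker_eq_bot'.2 ?_
    rintro ⟨dv, du⟩ h
    rw [hG'eq] at h
    obtain ⟨h1, h2⟩ := Prod.mk.inj h
    obtain rfl : dv = 0 := h1
    rw [hinj du h2]; rfl
  have hrange : (G' : E × W →ₗ[ℝ] E × W).range = ⊤ := by
    refine LinearMap.range_eq_top.2 ?_
    rintro ⟨dv, b⟩
    obtain ⟨du, hdu⟩ := hsurj (b - F' (dv, 0))
    refine ⟨(dv, du), ?_⟩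
    rw [hG'eq]
    refine Prod.ext rfl ?_
    change F' (dv, du) = b
    have : ((dv, du) : E × W) = (dv, 0) + (0, du) := by simp
    rw [this, map_add, hdu]
    abel
  let e := ContinuousLinearEquiv.ofBijective G' hker hrange
  have hstrict : HasStrictFDerivAt G (e : E × W →L[ℝ] E × W) (v₀, u₀) :=
    hG.contDiffAt.hasStrictFDerivAt one_ne_zero
  let Ψ := hstrict.toOpenPartialHomeomorph G
  have hΨ : ∀ z, Ψ z = G z := fun z => rfl
  have hsrc : (v₀, u₀) ∈ Ψ.source := hstrict.mem_toOpenPartialHomeomorph_source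
  let S : Set (E × W) := fderiv ℝ G ⁻¹'
    Set.range (ContinuousLinearEquiv.toContinuousLinearMap (σ₁₂ := RingHom.id ℝ))
  have hS : IsOpen S := ContinuousLinearEquiv.isOpen.preimage (hG.continuous_fderiv one_ne_zero)
  let T : Set (E × W) := Ψ.target ∩ Ψ.symm ⁻¹' S
  have hT : IsOpen T := Ψ.isOpen_inter_preimage_symm hS
  have hG₀ : Ψ (v₀, u₀) = (v₀, 0) := by rw [hΨ]; exact Prod.ext rfl h₀
  have hsymm₀ : Ψ.symm (v₀, 0) = (v₀, u₀) := by rw [← hG₀, Ψ.left_inv hsrc]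
  have hι : ∀ n : WithTop ℕ∞, ContDiff ℝ n fun v : E => ((v, 0) : E × W) := fun n =>
    contDiff_id.prodMk contDiff_const
  refine ⟨(fun v => (v, 0)) ⁻¹' T, hT.preimage (hι 0).continuous, ⟨?_, ?_⟩,
    fun v => (Ψ.symm (v, 0)).2, ?_, ?_, ?_⟩
  · change (v₀, 0) ∈ Ψ.target
    rw [← hG₀]
    exact Ψ.map_source hsrc
  · change Ψ.symm (v₀, 0) ∈ S
    rw [hsymm₀]
    exact ⟨e, rfl⟩
  · simp only [hsymm₀]
  · rintro v ⟨hv, -⟩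
    have h := Ψ.right_inv hv
    obtain ⟨h1, h2⟩ := Prod.mk.inj h
    have h3 : (v, (Ψ.symm (v, 0)).2) = Ψ.symm (v, 0) := Prod.ext h1.symm rfl
    rw [h3]
    exact h2
  · rintro n hn v ⟨hv, e', he'⟩
    have hd : HasFDerivAt Ψ (e' : E × W →L[ℝ] E × W) (Ψ.symm (v, 0)) := by
      rw [he']
      exact (hG.differentiable one_ne_zero _).hasFDerivAt
    have h := Ψ.contDiffAt_symm hv hd (hGn n hn).contDiffAt
    exact (contDiffAt_snd.comp v (h.comp v (hι n).contDiffAt)).contDiffWithinAt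

/-! ### Local minimality of the norm on an affine subspace -/

/-- If `q` is the component of `p₀` orthogonal to `K`, then `‖p₀ - t q‖² = ‖p₀‖² - t (2 - t) ‖q‖²`,
so a small step along `-q` shortens `p₀` unless `q = 0`. -/
theorem mem_of_eventually_norm_le {H : Type*} [NormedAddCommGroup H] [InnerProductSpace ℝ H]
    (K : Submodule ℝ H) [K.HasOrthogonalProjection] {p₀ : H}
    (h : ∀ᶠ p in 𝓝 p₀, p - p₀ ∈ Kᗮ → ‖p₀‖ ≤ ‖p‖) : p₀ ∈ K := by
  set q : H := p₀ - K.starProjection p₀ with hq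
  have hqK : q ∈ Kᗮ := K.sub_starProjection_mem_orthogonal p₀
  have hinner : inner ℝ p₀ q = ‖q‖ ^ 2 := by
    have e : p₀ = q + K.starProjection p₀ := by rw [hq]; abel
    conv_lhs => rw [e]
    rw [inner_add_left, real_inner_self_eq_norm_sq,
      Submodule.inner_right_of_mem_orthogonal (K.starProjection_apply_mem p₀) hqK, add_zero]
  have hcont : Tendsto (fun t : ℝ => p₀ - t • q) (𝓝[>] 0) (𝓝 p₀) := by
    have : Continuous fun t : ℝ => p₀ - t • q := by fun_prop
    simpa using (this.tendsto 0).mono_left nhdsWithin_le_nhds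
  have hlt : ∀ᶠ t : ℝ in 𝓝[>] 0, t < 1 :=
    (eventually_lt_nhds one_pos).filter_mono nhdsWithin_le_nhds
  obtain ⟨t, ht, ht1, ht0⟩ := ((hcont.eventually h).and (hlt.and self_mem_nhdsWithin)).exists
  have ht0 : 0 < t := ht0
  have h1 : ‖p₀‖ ≤ ‖p₀ - t • q‖ := by
    refine ht ?_
    rw [sub_sub_cancel_left]
    exact Kᗮ.neg_mem (Kᗮ.smul_mem t hqK)
  have h2 : ‖p₀‖ ^ 2 ≤ ‖p₀ - t • q‖ ^ 2 := by gcongr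
  rw [norm_sub_sq_real, inner_smul_right, hinner, norm_smul, Real.norm_of_nonneg ht0.le] at h2
  have h3 : t * (2 - t) * ‖q‖ ^ 2 ≤ 0 := by nlinarith
  have h4 : ‖q‖ ^ 2 ≤ 0 := by
    by_contra! hpos
    have : 0 < t * (2 - t) * ‖q‖ ^ 2 := by
      have : 0 < 2 - t := by linarith
      positivity
    linarith
  have h5 : q = 0 := norm_eq_zero.1 (pow_eq_zero_iff two_ne_zero |>.1 (h4.antisymm (sq_nonneg _)))
  rw [sub_eq_zero.1 h5]
  exact K.starProjection_apply_mem p₀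

/-! ### Stability of nondegenerate certificates -/

theorem lt_of_deriv2_neg {g g' g'' : ℝ → ℝ} {s : Set ℝ} (hs : Convex ℝ s)
    (hg : ∀ t, HasDerivAt g (g' t) t) (hg' : ∀ t, HasDerivAt g' (g'' t) t)
    (hneg : ∀ t ∈ s, g'' t < 0) {x : ℝ} (hx : x ∈ s) (hx0 : g' x = 0) {t : ℝ} (ht : t ∈ s)
    (htx : t ≠ x) : g t < g x := by
  have hconc : StrictConcaveOn ℝ s g := by
    refine strictConcaveOn_of_deriv2_neg hs
      (fun t _ => (hg t).continuousAt.continuousWithinAt) fun t ht => ?_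
    have e : deriv g = g' := funext fun t => (hg t).deriv
    simp only [Function.iterate_succ, Function.iterate_zero, Function.comp_apply, id, e,
      (hg' t).deriv]
    exact hneg t (interior_subset ht)
  have hd := hg x
  rw [hx0] at hd
  rcases htx.lt_or_gt with h | h
  · have := hconc.lt_slope_of_hasDerivAt ht hx h hd
    rw [slope_def_field, lt_div_iff₀ (by linarith)] at this
    linarith
  · have := hconc.slope_lt_of_hasDerivAt hx ht h hd
    rw [slope_def_field, div_lt_iff₀ (by linarith)] at this
    linarith

/-- Near `X₀ i` the function `s i * ⟪ψ t, p⟫` remains strictly concave and positive; its critical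
point `q.1 i` has value 1, so it lies in `(0, 1)` at other nearby points. Away from the spikes, the
strict bound persists by compactness. It is used with fixed positions to place `p₀` in the tangent
span, and with moving ones along the branch. -/
theorem eventually_certificate {H : Type*} [NormedAddCommGroup H] [InnerProductSpace ℝ H]
    {ψ : ℝ → H} (hψ : ContDiff ℝ 2 ψ)
    (hper : ∀ s t : ℝ, (s : Torus) = t → ψ s = ψ t) {N : ℕ} {X₀ s : Fin N → ℝ}
    (hs : ∀ i, s i = 1 ∨ s i = -1) {p₀ : H}
    (hoff : ∀ t : ℝ, (∀ i, (t : Torus) ≠ X₀ i) → |inner ℝ (ψ t) p₀| < 1)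
    (hX : ∀ i, inner ℝ (ψ (X₀ i)) p₀ = s i)
    (h2 : ∀ i, s i * inner ℝ (deriv (deriv ψ) (X₀ i)) p₀ < 0) :
    ∀ᶠ q : (Fin N → ℝ) × H in 𝓝 (X₀, p₀),
      (∀ i, inner ℝ (ψ (q.1 i)) q.2 = s i ∧ inner ℝ (deriv ψ (q.1 i)) q.2 = 0) →
      ∀ t : ℝ, (∀ i, (t : Torus) ≠ q.1 i) → |inner ℝ (ψ t) q.2| < 1 := by
  have hψ1 : ContDiff ℝ 1 (deriv ψ) :=
    (contDiff_succ_iff_deriv.1 (by simpa [one_add_one_eq_two] using hψ)).2.2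
  have c0 : Continuous ψ := hψ.continuous
  have c2 : Continuous (deriv (deriv ψ)) := hψ1.continuous_deriv le_rfl
  have d0 : ∀ t, HasDerivAt ψ (deriv ψ t) t := fun t =>
    (hψ.differentiable (by norm_num) t).hasDerivAt
  have d1 : ∀ t, HasDerivAt (deriv ψ) (deriv (deriv ψ) t) t := fun t =>
    (hψ1.differentiable (by norm_num) t).hasDerivAt
  have hss : ∀ i, s i * s i = 1 := fun i => by rcases hs i with h | h <;> simp [h]
  have hloc : ∀ i, ∃ r > 0, ∀ t ∈ Metric.ball (X₀ i) r, ∀ p ∈ Metric.ball p₀ r,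
      s i * inner ℝ (deriv (deriv ψ) t) p < 0 ∧ 0 < s i * inner ℝ (ψ t) p := by
    intro i
    have h1 : ∀ᶠ z : ℝ × H in 𝓝 (X₀ i, p₀), s i * inner ℝ (deriv (deriv ψ) z.1) z.2 < 0 :=
      (by fun_prop : Continuous fun z : ℝ × H => s i * inner ℝ (deriv (deriv ψ) z.1) z.2
        ).continuousAt.eventually_lt_const (h2 i)
    have h3 : ∀ᶠ z : ℝ × H in 𝓝 (X₀ i, p₀), 0 < s i * inner ℝ (ψ z.1) z.2 :=
      (by fun_prop : Continuous fun z : ℝ × H => s i * inner ℝ (ψ z.1) z.2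
        ).continuousAt.eventually_const_lt (by simp only [hX, hss, one_pos])
    obtain ⟨r, hr, h⟩ := Metric.eventually_nhds_iff_ball.1 (h1.and h3)
    refine ⟨r, hr, fun t ht p hp => h (t, p) ?_⟩
    rw [← ball_prod_same]
    exact ⟨ht, hp⟩
  choose r hr hloc using hloc
  let O : Fin N → Set Torus := fun i => Set.image (fun t : ℝ => (t : Torus)) (Metric.ball (X₀ i) (r i))
  have hO : ∀ i, IsOpen (O i) := fun i =>
    QuotientAddGroup.isOpenMap_coe _ Metric.isOpen_ball
  -- One period is enough by `hper`, and it makes the region away from the spikes compact.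
  let K : Set ℝ := Set.Icc 0 1 ∩ (fun t : ℝ => (t : Torus)) ⁻¹' (⋃ i, O i)ᶜ
  have hK : IsCompact K := isCompact_Icc.inter_right
    ((isOpen_iUnion hO).isClosed_compl.preimage (AddCircle.continuous_mk' 1))
  have hKev : ∀ᶠ p in 𝓝 p₀, ∀ t ∈ K, |inner ℝ (ψ t) p| < 1 := by
    refine hK.eventually_forall_of_forall_eventually fun t ht => ?_
    refine (by fun_prop : Continuous fun z : H × ℝ => |inner ℝ (ψ z.2) z.1|
      ).continuousAt.eventually_lt_const (hoff t fun i hi => ht.2 ?_)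
    exact Set.mem_iUnion.2 ⟨i, X₀ i, Metric.mem_ball_self (hr i), hi.symm⟩
  have hpball : ∀ᶠ q : (Fin N → ℝ) × H in 𝓝 (X₀, p₀), ∀ i, q.2 ∈ Metric.ball p₀ (r i) :=
    eventually_all.2 fun i =>
      (continuous_snd.tendsto (X₀, p₀)).eventually (Metric.ball_mem_nhds _ (hr i))
  have hXball : ∀ᶠ q : (Fin N → ℝ) × H in 𝓝 (X₀, p₀), ∀ i, q.1 i ∈ Metric.ball (X₀ i) (r i) :=
    eventually_all.2 fun i => ((by fun_prop : Continuous fun q : (Fin N → ℝ) × H => q.1 i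
      ).tendsto (X₀, p₀)).eventually (Metric.ball_mem_nhds _ (hr i))
  filter_upwards [hpball, hXball, (continuous_snd.tendsto (X₀, p₀)).eventually hKev]
    with q hqp hqX hqK hq t ht
  by_cases hmem : (t : Torus) ∈ ⋃ i, O i
  · obtain ⟨i, t', ht', htt⟩ := Set.mem_iUnion.1 hmem
    have htt : (t' : Torus) = t := htt
    rw [← hper t' t htt]
    have hpos := (hloc i t' ht' q.2 (hqp i)).2
    have hne : t' ≠ q.1 i := fun h => ht i (by rw [← htt, h])
    have hlt : s i * inner ℝ (ψ t') q.2 < s i * inner ℝ (ψ (q.1 i)) q.2 := by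
      refine lt_of_deriv2_neg (g := fun t => s i * inner ℝ (ψ t) q.2)
        (g' := fun t => s i * inner ℝ (deriv ψ t) q.2)
        (g'' := fun t => s i * inner ℝ (deriv (deriv ψ) t) q.2)
        (convex_ball (X₀ i) (r i)) ?_ ?_ (fun t ht => (hloc i t ht q.2 (hqp i)).1) (hqX i)
        (by simp [(hq i).2]) ht' hne
      · intro t
        simpa using ((d0 t).inner ℝ (hasDerivAt_const t q.2)).const_mul (s i)
      · intro t
        simpa using ((d1 t).inner ℝ (hasDerivAt_const t q.2)).const_mul (s i)
    rw [(hq i).1, hss] at hlt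
    rw [abs_lt]
    rcases hs i with h | h <;> rw [h] at hlt hpos <;> constructor <;> linarith
  · obtain ⟨t', ht', htt⟩ : (t : Torus) ∈
      Set.image (fun t : ℝ => (t : Torus)) (Set.Ico 0 (0 + 1)) := by
      rw [AddCircle.coe_image_Ico_eq]; trivial
    have htt : (t' : Torus) = t := htt
    rw [← hper t' t htt]
    refine hqK t' ⟨⟨ht'.1, by linarith [ht'.2]⟩, ?_⟩
    change (t' : Torus) ∉ ⋃ i, O i
    rwa [htt]

/-! ### The first order optimality system -/

section Optimality

variable {H : Type*} [NormedAddCommGroup H] [InnerProductSpace ℝ H] {N : ℕ}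

/-- The residual `∑ i, a i • ψ (X i) - y - w` at `((lam, w), (a, X))`. -/
def spikeResidual (ψ : ℝ → H) (y : H) (z : (ℝ × H) × ((Fin N → ℝ) × (Fin N → ℝ))) : H :=
  ∑ i, z.2.1 i • ψ (z.2.2 i) - y - z.1.2

/-- The equations `lam • Γ_X* p = lam • (s, 0)` for the dual variable `p = - residual / lam`. -/
noncomputable def optimalitySystem (ψ : ℝ → H) (y : H) (s : Fin N → ℝ)
    (z : (ℝ × H) × ((Fin N → ℝ) × (Fin N → ℝ))) : (Fin N → ℝ) × (Fin N → ℝ) :=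
  (fun i => inner ℝ (ψ (z.2.2 i)) (spikeResidual ψ y z) + z.1.1 * s i,
    fun i => inner ℝ (deriv ψ (z.2.2 i)) (spikeResidual ψ y z))

theorem contDiff_spikeResidual {n : WithTop ℕ∞} {ψ : ℝ → H} (hψ : ContDiff ℝ n ψ) (y : H) :
    ContDiff ℝ n (spikeResidual (N := N) ψ y) := by
  unfold spikeResidual
  fun_prop

theorem contDiff_optimalitySystem {n : WithTop ℕ∞} {ψ : ℝ → H} (hψ : ContDiff ℝ (n + 1) ψ)
    (y : H) (s : Fin N → ℝ) : ContDiff ℝ n (optimalitySystem ψ y s) := by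
  have h0 : ContDiff ℝ n ψ := hψ.of_le le_self_add
  have h1 : ContDiff ℝ n (deriv ψ) := (contDiff_succ_iff_deriv.1 hψ).2.2
  have hR := contDiff_spikeResidual (N := N) h0 y
  have hX : ∀ i, ContDiff ℝ n fun z : (ℝ × H) × ((Fin N → ℝ) × (Fin N → ℝ)) => z.2.2 i :=
    fun i => by fun_prop
  refine ContDiff.prodMk (contDiff_pi.2 fun i => ?_) (contDiff_pi.2 fun i => ?_)
  · exact ((h0.comp (hX i)).inner ℝ hR).add (by fun_prop)
  · exact (h1.comp (hX i)).inner ℝ hR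

variable {Z : Type*} [NormedAddCommGroup Z] [NormedSpace ℝ Z] {z₀ : Z}

theorem hasFDerivAt_sum_smul_feature {ψ : ℝ → H} (hψ : Differentiable ℝ ψ)
    {A X : Z → Fin N → ℝ} {A' X' : Z →L[ℝ] Fin N → ℝ} (hA : HasFDerivAt A A' z₀)
    (hX : HasFDerivAt X X' z₀) :
    ∃ S' : Z →L[ℝ] H, HasFDerivAt (fun z => ∑ i, A z i • ψ (X z i)) S' z₀ ∧
      ∀ z, S' z = ∑ i, (A' z i • ψ (X z₀ i) + (A z₀ i * X' z i) • deriv ψ (X z₀ i)) := by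
  rw [hasFDerivAt_pi'] at hA hX
  refine ⟨_, HasFDerivAt.fun_sum fun i _ => (hA i).smul
    ((hψ (X z₀ i)).hasDerivAt.hasFDerivAt.comp z₀ (hX i)), fun z => ?_⟩
  simp [mul_smul, add_comm]

/-- Where the residual vanishes, the term with the derivative of `g` drops out, so `ψ''` does not
enter the linearized system. -/
theorem hasFDerivAt_inner_of_eq_zero {g R : Z → H} {R' : Z →L[ℝ] H}
    (hg : DifferentiableAt ℝ g z₀) (hR : HasFDerivAt R R' z₀) (h0 : R z₀ = 0) :
    HasFDerivAt (fun z => inner ℝ (g z) (R z)) ((innerSL ℝ (g z₀)).comp R') z₀ := by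
  refine (hg.hasFDerivAt.inner ℝ hR).congr_fderiv ?_
  ext z
  simp [h0]

/-- The span of the features and of their derivatives at the points `X i`. -/
def tangentSpan (ψ : ℝ → H) (X : Fin N → ℝ) : Submodule ℝ H :=
  Submodule.span ℝ (Set.range (fun i => ψ (X i)) ∪ Set.range fun i => deriv ψ (X i))

instance finiteDimensional_tangentSpan (ψ : ℝ → H) (X : Fin N → ℝ) :
    FiniteDimensional ℝ (tangentSpan ψ X) :=
  FiniteDimensional.span_of_finite ℝ ((Set.finite_range _).union (Set.finite_range _))

theorem sum_mem_tangentSpan (ψ : ℝ → H) (X b c : Fin N → ℝ) :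
    ∑ i, (b i • ψ (X i) + c i • deriv ψ (X i)) ∈ tangentSpan ψ X :=
  Submodule.sum_mem _ fun i _ => Submodule.add_mem _
    (Submodule.smul_mem _ _ (Submodule.subset_span (Or.inl ⟨i, rfl⟩)))
    (Submodule.smul_mem _ _ (Submodule.subset_span (Or.inr ⟨i, rfl⟩)))

theorem mem_tangentSpan_orthogonal {ψ : ℝ → H} {X : Fin N → ℝ} {q : H} :
    q ∈ (tangentSpan ψ X)ᗮ ↔
      (∀ i, inner ℝ (ψ (X i)) q = 0) ∧ ∀ i, inner ℝ (deriv ψ (X i)) q = 0 := by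
  constructor
  · intro h
    exact ⟨fun i => h _ (Submodule.subset_span (Or.inl ⟨i, rfl⟩)),
      fun i => h _ (Submodule.subset_span (Or.inr ⟨i, rfl⟩))⟩
  · rintro ⟨h1, h2⟩
    rw [Submodule.mem_orthogonal]
    intro u hu
    induction hu using Submodule.span_induction with
    | mem u hu =>
      rcases hu with ⟨i, rfl⟩ | ⟨i, rfl⟩
      exacts [h1 i, h2 i]
    | zero => exact inner_zero_left _
    | add u v _ _ hu hv => rw [inner_add_left, hu, hv, add_zero]
    | smul c u _ hu => rw [inner_smul_left, hu, mul_zero]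

/-- The partial derivative of the optimality system in `(a, X)` is injective at the origin. -/
theorem fderiv_optimalitySystem_injective {ψ : ℝ → H} (hψ : ContDiff ℝ 2 ψ) {a₀ X₀ : Fin N → ℝ}
    (ha₀ : ∀ i, a₀ i ≠ 0)
    (hΓ : ∀ b c : Fin N → ℝ, ∑ i, (b i • ψ (X₀ i) + c i • deriv ψ (X₀ i)) = 0 → b = 0 ∧ c = 0)
    (s : Fin N → ℝ) (du : (Fin N → ℝ) × (Fin N → ℝ))
    (hdu : fderiv ℝ (optimalitySystem ψ (∑ i, a₀ i • ψ (X₀ i)) s)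
      ((0 : ℝ × H), (a₀, X₀)) (0, du) = 0) : du = 0 := by
  set y := ∑ i, a₀ i • ψ (X₀ i) with hy
  set z₀ : (ℝ × H) × ((Fin N → ℝ) × (Fin N → ℝ)) := (0, (a₀, X₀)) with hz₀
  have hψ1 : ContDiff ℝ 1 (deriv ψ) :=
    (contDiff_succ_iff_deriv.1 (by simpa [one_add_one_eq_two] using hψ)).2.2
  have hF : HasFDerivAt (optimalitySystem ψ y s) (fderiv ℝ (optimalitySystem ψ y s) z₀) z₀ :=
    ((contDiff_optimalitySystem (n := 1) (by simpa [one_add_one_eq_two] using hψ) y s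
      ).differentiable one_ne_zero z₀).hasFDerivAt
  set F' := fderiv ℝ (optimalitySystem ψ y s) z₀
  let V := (Fin N → ℝ)
  have hA : HasFDerivAt (fun z : (ℝ × H) × (V × V) => z.2.1)
      ((ContinuousLinearMap.fst ℝ V V).comp (ContinuousLinearMap.snd ℝ (ℝ × H) (V × V))) z₀ :=
    hasFDerivAt_snd.fst
  have hX : HasFDerivAt (fun z : (ℝ × H) × (V × V) => z.2.2)
      ((ContinuousLinearMap.snd ℝ V V).comp (ContinuousLinearMap.snd ℝ (ℝ × H) (V × V))) z₀ :=
    hasFDerivAt_snd.snd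
  have hw : HasFDerivAt (fun z : (ℝ × H) × (V × V) => z.1.2)
      ((ContinuousLinearMap.snd ℝ ℝ H).comp (ContinuousLinearMap.fst ℝ (ℝ × H) (V × V))) z₀ :=
    hasFDerivAt_fst.snd
  have hl : HasFDerivAt (fun z : (ℝ × H) × (V × V) => z.1.1)
      ((ContinuousLinearMap.fst ℝ ℝ H).comp (ContinuousLinearMap.fst ℝ (ℝ × H) (V × V))) z₀ :=
    hasFDerivAt_fst.fst
  obtain ⟨S', hS', hS'eq⟩ := hasFDerivAt_sum_smul_feature
    (hψ.differentiable (by norm_num)) hA hX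
  have hR : HasFDerivAt (spikeResidual (N := N) ψ y) _ z₀ := (hS'.sub_const y).sub hw
  have hR0 : spikeResidual (N := N) ψ y z₀ = 0 := by simp [spikeResidual, hz₀, hy]
  have hSdu : S' (0, du) = ∑ i, (du.1 i • ψ (X₀ i) + (a₀ i * du.2 i) • deriv ψ (X₀ i)) :=
    hS'eq (0, du)
  have h1 : ∀ i, inner ℝ (ψ (X₀ i)) (S' (0, du)) = 0 := by
    intro i
    have e1 := (hasFDerivAt_pi'.1 hF.fst i)
    have hg : DifferentiableAt ℝ (fun z : (ℝ × H) × (V × V) => ψ (z.2.2 i)) z₀ :=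
      (hψ.differentiable (by norm_num) _).comp z₀ (by fun_prop)
    have e2 := (hasFDerivAt_inner_of_eq_zero hg hR hR0).add (hl.mul_const (s i))
    have := congrArg (fun L => L (0, du)) (e1.unique e2)
    simp only [ContinuousLinearMap.comp_apply, hdu] at this
    simpa [inner_sub_right] using this.symm
  have h2 : ∀ i, inner ℝ (deriv ψ (X₀ i)) (S' (0, du)) = 0 := by
    intro i
    have e1 := (hasFDerivAt_pi'.1 hF.snd i)
    have hg : DifferentiableAt ℝ (fun z : (ℝ × H) × (V × V) => deriv ψ (z.2.2 i)) z₀ :=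
      (hψ1.differentiable (by norm_num) _).comp z₀ (by fun_prop)
    have e2 := hasFDerivAt_inner_of_eq_zero hg hR hR0
    have := congrArg (fun L => L (0, du)) (e1.unique e2)
    simp only [ContinuousLinearMap.comp_apply, hdu] at this
    simpa [inner_sub_right] using this.symm
  have hmem : S' (0, du) ∈ tangentSpan ψ X₀ := by
    rw [hSdu]; exact sum_mem_tangentSpan ψ X₀ du.1 fun i => a₀ i * du.2 i
  -- The vector lies both in the tangent span and in its orthogonal.
  have hzero : S' (0, du) = 0 := (inner_self_eq_zero (𝕜 := ℝ)).1
    (mem_tangentSpan_orthogonal.2 ⟨h1, h2⟩ _ hmem)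
  rw [hSdu] at hzero
  obtain ⟨hb, hc⟩ := hΓ du.1 (fun i => a₀ i * du.2 i) hzero
  refine Prod.ext hb (funext fun i => ?_)
  exact (mul_eq_zero.1 (congrFun hc i)).resolve_left (ha₀ i)

/-- First order expansion of the residual along a branch of solutions of the optimality system:
up to the noise level, it is `-lam • p₀`. -/
theorem eventually_norm_residual_add_le {ψ : ℝ → H} (hψ : ContDiff ℝ 2 ψ) {a₀ X₀ s : Fin N → ℝ}
    {p₀ : H} (hp₀ : p₀ ∈ tangentSpan ψ X₀) (hX : ∀ i, inner ℝ (ψ (X₀ i)) p₀ = s i)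
    (hX' : ∀ i, inner ℝ (deriv ψ (X₀ i)) p₀ = 0)
    {u : ℝ × H → (Fin N → ℝ) × (Fin N → ℝ)} (hu : DifferentiableAt ℝ u 0)
    (hu0 : u 0 = (a₀, X₀))
    (hsol : ∀ᶠ v in 𝓝 0, optimalitySystem ψ (∑ i, a₀ i • ψ (X₀ i)) s (v, u v) = 0)
    {ε : ℝ} (hε : 0 < ε) :
    ∀ᶠ v : ℝ × H in 𝓝 0, ‖spikeResidual ψ (∑ i, a₀ i • ψ (X₀ i)) (v, u v) + v.1 • p₀‖ ≤
      ‖v.2‖ + ε * ‖v‖ := by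
  set y := ∑ i, a₀ i • ψ (X₀ i) with hy
  have hψ1 : ContDiff ℝ 1 (deriv ψ) :=
    (contDiff_succ_iff_deriv.1 (by simpa [one_add_one_eq_two] using hψ)).2.2
  have hA := hu.hasFDerivAt.fst
  have hXd := hu.hasFDerivAt.snd
  have hXi : ∀ i, DifferentiableAt ℝ (fun v => (u v).2 i) 0 := fun i =>
    (hasFDerivAt_pi'.1 hXd i).differentiableAt
  obtain ⟨S', hS', hS'eq⟩ := hasFDerivAt_sum_smul_feature
    (hψ.differentiable (by norm_num)) hA hXd
  have hR : HasFDerivAt (fun v => spikeResidual ψ y (v, u v))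
      (S' - ContinuousLinearMap.snd ℝ ℝ H) 0 :=
    (hS'.sub_const y).sub hasFDerivAt_snd
  have hR0 : spikeResidual ψ y ((0 : ℝ × H), u 0) = 0 := by simp [spikeResidual, hu0, hy]
  set R' := S' - ContinuousLinearMap.snd ℝ ℝ H with hR'
  -- Differentiating the equations makes `R' v + v.1 • p₀` orthogonal to the tangent span, while
  -- adding `v.2` puts it in the span, thanks to `hp₀`. It is therefore minus the projection of
  -- `v.2` on the orthogonal complement.
  have hlin : ∀ v, ‖R' v + v.1 • p₀‖ ≤ ‖v.2‖ := by
    intro v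
    have h1 : ∀ i, inner ℝ (ψ (X₀ i)) (R' v + v.1 • p₀) = 0 := by
      intro i
      have e1 := hasFDerivAt_inner_of_eq_zero (g := fun v => ψ ((u v).2 i))
        ((hψ.differentiable (by norm_num) _).comp 0 (hXi i)) hR hR0
      have e2 : HasFDerivAt (fun v : ℝ × H => -(v.1 * s i))
          (-((s i) • ContinuousLinearMap.fst ℝ ℝ H)) 0 :=
        ((ContinuousLinearMap.fst ℝ ℝ H).hasFDerivAt.mul_const (s i)).neg
      have e3 : (fun v => inner ℝ (ψ ((u v).2 i)) (spikeResidual ψ y (v, u v))) =ᶠ[𝓝 0]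
          fun v : ℝ × H => -(v.1 * s i) := by
        filter_upwards [hsol] with v hv
        exact eq_neg_of_add_eq_zero_left (congrFun (congrArg Prod.fst hv) i)
      have := congrArg (fun L => L v) (e1.unique (e2.congr_of_eventuallyEq e3))
      simp only [hu0, ContinuousLinearMap.comp_apply, innerSL_apply_apply,
        _root_.neg_apply, _root_.smul_apply,
        ContinuousLinearMap.coe_fst', smul_eq_mul] at this
      rw [inner_add_right, inner_smul_right, hX, this]
      ring
    have h2 : ∀ i, inner ℝ (deriv ψ (X₀ i)) (R' v + v.1 • p₀) = 0 := by
      intro i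
      have e1 := hasFDerivAt_inner_of_eq_zero (g := fun v => deriv ψ ((u v).2 i))
        ((hψ1.differentiable (by norm_num) _).comp 0 (hXi i)) hR hR0
      have e3 : (fun v => inner ℝ (deriv ψ ((u v).2 i)) (spikeResidual ψ y (v, u v))) =ᶠ[𝓝 0]
          fun _ : ℝ × H => (0 : ℝ) := by
        filter_upwards [hsol] with v hv
        exact congrFun (congrArg Prod.snd hv) i
      have := congrArg (fun L => L v)
        (e1.unique ((hasFDerivAt_const (0 : ℝ) _).congr_of_eventuallyEq e3))
      simp only [hu0, ContinuousLinearMap.comp_apply, innerSL_apply_apply,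
        _root_.zero_apply] at this
      rw [inner_add_right, inner_smul_right, hX', this]
      ring
    have hmem : S' v + v.1 • p₀ ∈ tangentSpan ψ X₀ := by
      refine Submodule.add_mem _ ?_ (Submodule.smul_mem _ _ hp₀)
      rw [hS'eq]
      simp only [hu0]
      exact sum_mem_tangentSpan ψ X₀ _ fun i => _
    have horth := mem_tangentSpan_orthogonal.2 ⟨h1, h2⟩ _ hmem
    have e : S' v + v.1 • p₀ = (R' v + v.1 • p₀) + v.2 := by
      simp only [hR', _root_.sub_apply, ContinuousLinearMap.coe_snd']
      abel
    rw [e, inner_add_left, real_inner_self_eq_norm_sq] at horth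
    have hcs := abs_le.1 (abs_real_inner_le_norm v.2 (R' v + v.1 • p₀))
    by_contra! hlt
    nlinarith [norm_nonneg v.2]
  have hsmall := hR.isLittleO.def hε
  filter_upwards [hsmall] with v hv
  rw [hR0, sub_zero, sub_zero] at hv
  calc ‖spikeResidual ψ y (v, u v) + v.1 • p₀‖
      = ‖(R' v + v.1 • p₀) + (spikeResidual ψ y (v, u v) - R' v)‖ := by congr 1; abel
    _ ≤ ‖v.2‖ + ε * ‖v‖ := (norm_add_le _ _).trans (add_le_add (hlin v) hv)

end Optimality

/-! ### Consequences of the Non Degenerate Source Condition -/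

section SourceCondition

variable {φ : C(Torus, ℝ)} {N : ℕ} {a X s : Fin N → ℝ} {p : L2}

theorem norm_PhiAdj_le_one (hs : ∀ i, s i = 1 ∨ s i = -1)
    (hX : ∀ i, inner ℝ (feature φ (X i)) p = s i)
    (hoff : ∀ t : ℝ, (∀ i, (t : Torus) ≠ X i) → |inner ℝ (feature φ t) p| < 1) :
    ‖PhiAdj φ p‖ ≤ 1 := by
  refine (ContinuousMap.norm_le _ zero_le_one).2 fun t => ?_
  obtain ⟨t, rfl⟩ := QuotientAddGroup.mk_surjective t
  change |PhiAdj φ p (t : Torus)| ≤ 1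
  by_cases h : ∃ i, (t : Torus) = X i
  · obtain ⟨i, hi⟩ := h
    rw [hi, ← inner_feature, hX]
    rcases hs i with h | h <;> simp [h]
  · push Not at h
    rw [← inner_feature]
    exact (hoff t h).le

theorem norm_le_apply_of_isDualSolution {m : Radon} (hm : ∃ q, PhiAdj φ q ∈ subdiffTV m)
    (hp : IsDualSolution φ (Phi φ m) p) : ‖m‖ ≤ m (PhiAdj φ p) := by
  obtain ⟨q, hq⟩ := hm
  have h := hp.2 q (norm_le_one_of_mem_subdiffTV hq)
  rw [inner_Phi, inner_Phi] at h
  exact (norm_le_apply_of_mem_subdiffTV hq).trans h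

/-- The source condition makes the dual value reach `∑ |a i|`; as no term exceeds `|a i|`, all are
equalities. -/
theorem eq_sign_of_isDualSolution {x : Fin N → Torus} (ha : ∀ i, a i ≠ 0)
    (hx : Function.Injective x) (hm : ∃ q, PhiAdj φ q ∈ subdiffTV (discreteMeasure a x))
    (hp : IsDualSolution φ (Phi φ (discreteMeasure a x)) p) (i : Fin N) :
    PhiAdj φ p (x i) = SignType.sign (a i) := by
  have h := norm_le_apply_of_isDualSolution hm hp
  rw [norm_discreteMeasure a hx, discreteMeasure_apply] at h
  have hle : ∀ j ∈ Finset.univ, a j * PhiAdj φ p (x j) ≤ |a j| := fun j _ => by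
    refine (le_abs_self _).trans ?_
    rw [abs_mul]
    exact mul_le_of_le_one_right (abs_nonneg _)
      (((PhiAdj φ p).norm_coe_le_norm (x j)).trans hp.1)
  have heq := (Finset.sum_eq_sum_iff_of_le hle).1 ((Finset.sum_le_sum hle).antisymm h) i
    (Finset.mem_univ i)
  rw [← self_mul_sign] at heq
  exact mul_left_cancel₀ (ha i) heq

theorem inner_deriv_feature_eq_zero (hφ : IsC 2 φ) (hp : ‖PhiAdj φ p‖ ≤ 1) {t s : ℝ}
    (hs : s = 1 ∨ s = -1) (ht : inner ℝ (feature φ t) p = s) :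
    inner ℝ (deriv (feature φ) t) p = 0 := by
  have hψ : ContDiff ℝ 2 (feature φ) := contDiff_feature (n := 2) hφ
  have hd : HasDerivAt (fun r => s * inner ℝ (feature φ r) p)
      (s * inner ℝ (deriv (feature φ) t) p) t := by
    simpa using ((hψ.differentiable (by norm_num) t).hasDerivAt.inner ℝ
      (hasDerivAt_const t p)).const_mul s
  have hmax : IsLocalMax (fun r => s * inner ℝ (feature φ r) p) t := by
    refine Eventually.of_forall fun r => ?_
    have h := abs_le.1 (((PhiAdj φ p).norm_coe_le_norm (r : Torus)).trans hp)
    simp only [ht, inner_feature]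
    rcases hs with rfl | rfl <;> linarith
  have := hmax.hasDerivAt_eq_zero hd
  rcases hs with rfl | rfl <;> simpa using this

/-- Otherwise the product would be positive and `t` a strict local minimum of `s * Φ* p`, which
would then exceed 1 nearby. -/
theorem inner_deriv_deriv_feature_neg (hφ : IsC 2 φ) (hp : ‖PhiAdj φ p‖ ≤ 1) {t s : ℝ}
    (hs : s = 1 ∨ s = -1) (ht : inner ℝ (feature φ t) p = s)
    (hne : inner ℝ (deriv (deriv (feature φ)) t) p ≠ 0) :
    s * inner ℝ (deriv (deriv (feature φ)) t) p < 0 := by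
  have hψ : ContDiff ℝ 2 (feature φ) := contDiff_feature (n := 2) hφ
  have hψ1 : ContDiff ℝ 1 (deriv (feature φ)) :=
    (contDiff_succ_iff_deriv.1 (by simpa [one_add_one_eq_two] using hψ)).2.2
  have hc : Continuous (deriv (deriv (feature φ))) := hψ1.continuous_deriv le_rfl
  have hs0 : s ≠ 0 := by rcases hs with rfl | rfl <;> norm_num
  by_contra! hge
  have hpos : -(s * inner ℝ (deriv (deriv (feature φ)) t) p) < 0 :=
    neg_neg_of_pos (hge.lt_of_ne (mul_ne_zero hs0 hne).symm)
  obtain ⟨r, hr, hball⟩ := Metric.eventually_nhds_iff_ball.1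
    ((by fun_prop : Continuous fun τ => -(s * inner ℝ (deriv (deriv (feature φ)) τ) p)
      ).continuousAt.eventually_lt_const hpos)
  have hlt := lt_of_deriv2_neg (g := fun τ => -(s * inner ℝ (feature φ τ) p))
    (g' := fun τ => -(s * inner ℝ (deriv (feature φ) τ) p)) (convex_ball t r)
    (fun τ => by
      simpa using (((hψ.differentiable (by norm_num) τ).hasDerivAt.inner ℝ
        (hasDerivAt_const τ p)).const_mul s).fun_neg)
    (fun τ => by
      simpa using (((hψ1.differentiable (by norm_num) τ).hasDerivAt.inner ℝ
        (hasDerivAt_const τ p)).const_mul s).fun_neg)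
    hball (Metric.mem_ball_self hr) (by simp [inner_deriv_feature_eq_zero hφ hp hs ht])
    (t := t + r / 2) (by simp [abs_of_pos hr]; linarith) (by linarith)
  have h := abs_le.1 (((PhiAdj φ p).norm_coe_le_norm ((t + r / 2 : ℝ) : Torus)).trans hp)
  rw [← inner_feature] at h
  simp only [ht] at hlt
  rcases hs with rfl | rfl <;> linarith

/-- Under the Non Degenerate Source Condition, the minimal norm certificate is the vanishing
derivatives precertificate: it lies in the range of `Γ_X`. -/
theorem mem_tangentSpan_of_isMinNormDualSolution (hφ : IsC 2 φ) (hs : ∀ i, s i = 1 ∨ s i = -1)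
    (hp : IsMinNormDualSolution φ (Phi φ (discreteMeasure a fun i => (X i : Torus))) p)
    (hX : ∀ i, inner ℝ (feature φ (X i)) p = s i)
    (hoff : ∀ t : ℝ, (∀ i, (t : Torus) ≠ X i) → |inner ℝ (feature φ t) p| < 1)
    (h2 : ∀ i, s i * inner ℝ (deriv (deriv (feature φ)) (X i)) p < 0) :
    p ∈ tangentSpan (feature φ) X := by
  have hev := eventually_certificate (contDiff_feature (n := 2) hφ)
    (fun s t h => by simp only [feature, h]) hs hoff hX h2
  refine mem_of_eventually_norm_le _ ?_
  have hcont : Continuous fun q : L2 => (X, q) := by fun_prop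
  filter_upwards [(hcont.tendsto p).eventually hev] with q hq hqK
  -- Being orthogonal to the span, `q - p` changes neither the interpolation data nor the dual
  -- objective. So `q` is again a dual solution, and `p` has the smaller norm.
  obtain ⟨h0, h1⟩ := mem_tangentSpan_orthogonal.1 hqK
  have hqX : ∀ i, inner ℝ (feature φ (X i)) q = s i := fun i => by
    have := h0 i
    rw [inner_sub_right, hX] at this
    linarith
  have hqX' : ∀ i, inner ℝ (deriv (feature φ) (X i)) q = 0 := fun i => by
    have := h1 i
    rw [inner_sub_right, inner_deriv_feature_eq_zero hφ hp.1.1 (hs i) (hX i)] at this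
    linarith
  have hq1 : ‖PhiAdj φ q‖ ≤ 1 := norm_PhiAdj_le_one hs hqX (hq fun i => ⟨hqX i, hqX' i⟩)
  refine hp.2 q ⟨hq1, fun q' hq' => (hp.1.2 q' hq').trans_eq ?_⟩
  simp only [Phi_discreteMeasure, sum_inner, inner_smul_left, hX, hqX]

end SourceCondition

/-! ### Real lifts of positions and the small noise domain -/

theorem exists_lift {N : ℕ} (x : Fin N → Torus) :
    ∃ X : Fin N → ℝ, x = fun i => (X i : Torus) := by
  choose X hX using fun i => QuotientAddGroup.mk_surjective (x i)
  exact ⟨X, funext fun i => (hX i).symm⟩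

theorem Gam_coe (φ : C(Torus, ℝ)) (hφ : IsC 2 φ) {N : ℕ} (X b c : Fin N → ℝ) :
    Gam φ hφ (fun i => (X i : Torus)) (b, c) =
      ∑ i, (b i • feature φ (X i) + c i • deriv (feature φ) (X i)) := by
  rw [Gam, Phi_discreteMeasure, Phi_derivC_discreteMeasure, Finset.sum_add_distrib]

theorem norm_le_of_mem_smallNoise {α lam0 : ℝ} (hα : α ≤ 1) {v : ℝ × L2}
    (hv : v ∈ smallNoise α lam0) : ‖v‖ ≤ v.1 := by
  obtain ⟨h0, -, h2⟩ := hv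
  rw [Prod.norm_def, Real.norm_of_nonneg h0]
  exact max_le le_rfl (h2.trans (mul_le_of_le_one_left h0 hα))

end SpikeDeconv

open SpikeDeconv

theorem mainTheorem1 (φ : C(Torus, ℝ)) (hφ : IsC 2 φ) {N : ℕ}
    (a₀ : Fin N → ℝ) (x₀ : Fin N → Torus)
    (ha₀ : ∀ i, a₀ i ≠ 0) (hx₀ : Function.Injective x₀)
    (hΓ : Function.Injective (Gam φ hφ x₀))
    (hN : NDSC φ a₀ x₀) :
    ∃ α > 0, ∃ lam0 > 0, ∃ (a : ℝ × L2 → Fin N → ℝ) (x : ℝ × L2 → Fin N → Torus),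
      -- the solution is unique and has exactly `N` spikes, with the signs of `a₀`
      (∀ lam : ℝ, ∀ w : L2, (lam, w) ∈ smallNoise α lam0 →
        {m : Radon | IsPrimalSolution φ lam (Phi φ (discreteMeasure a₀ x₀) + w) m} =
            {discreteMeasure (a (lam, w)) (x (lam, w))} ∧
          Function.Injective (x (lam, w)) ∧
          ∀ i, a (lam, w) i ≠ 0 ∧ SignType.sign (a (lam, w) i) = SignType.sign (a₀ i)) ∧
      a (0, 0) = a₀ ∧ x (0, 0) = x₀ ∧
      -- amplitudes and positions are `C^{k-1}`, up to the boundary of the domain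
      (∃ U : Set (ℝ × L2), IsOpen U ∧ smallNoise α lam0 ⊆ U ∧
        ∀ k : ℕ, 2 ≤ k → IsC k φ →
          ContDiffOn ℝ (k - 1 : ℕ) a U ∧ TorusContDiffOn (k - 1 : ℕ) x U) ∧
      -- linear convergence for `lam = ‖w‖ / α`
      ∃ C : ℝ, ∀ w : L2, ‖w‖ / α ≤ lam0 → ∀ i,
        ‖x (‖w‖ / α, w) i - x₀ i‖ ≤ C * ‖w‖ ∧ |a (‖w‖ / α, w) i - a₀ i| ≤ C * ‖w‖ := by
  obtain ⟨X₀, rfl⟩ := exists_lift x₀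
  obtain ⟨hsource, p₀, hp₀, hoff, hnd⟩ := hN
  set ψ := feature φ with hψdef
  have hψ : ContDiff ℝ 2 ψ := contDiff_feature (n := 2) hφ
  have hper : ∀ s t : ℝ, (s : Torus) = t → ψ s = ψ t := fun s t h => by
    simp only [hψdef, feature, h]
  let s : Fin N → ℝ := fun i => SignType.sign (a₀ i)
  have hs : ∀ i, s i = 1 ∨ s i = -1 := fun i => by
    rcases (ha₀ i).lt_or_gt with h | h <;> simp [s, h]
  have hX₀ : ∀ i, inner ℝ (ψ (X₀ i)) p₀ = s i := fun i => by
    rw [inner_feature]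
    exact eq_sign_of_isDualSolution ha₀ hx₀ hsource hp₀.1 i
  have hX₀' : ∀ i, inner ℝ (deriv ψ (X₀ i)) p₀ = 0 := fun i =>
    inner_deriv_feature_eq_zero hφ hp₀.1.1 (hs i) (hX₀ i)
  have hX₀'' : ∀ i, s i * inner ℝ (deriv (deriv ψ) (X₀ i)) p₀ < 0 := fun i =>
    inner_deriv_deriv_feature_neg hφ hp₀.1.1 (hs i) (hX₀ i) (by
      rw [← torusDeriv_torusDeriv_PhiAdj hφ]; exact hnd i)
  have hoff' : ∀ t : ℝ, (∀ i, (t : Torus) ≠ X₀ i) → |inner ℝ (ψ t) p₀| < 1 := fun t ht => by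
    rw [inner_feature]
    refine hoff _ ?_
    rintro ⟨i, hi⟩
    exact ht i hi.symm
  have hspan : p₀ ∈ tangentSpan ψ X₀ :=
    mem_tangentSpan_of_isMinNormDualSolution hφ hs hp₀ hX₀ hoff' hX₀''
  have hΓ' : ∀ b c : Fin N → ℝ, ∑ i, (b i • ψ (X₀ i) + c i • deriv ψ (X₀ i)) = 0 →
      b = 0 ∧ c = 0 := fun b c h => by
    have e : Gam φ hφ (fun i => (X₀ i : Torus)) (b, c) =
        Gam φ hφ (fun i => (X₀ i : Torus)) (0, 0) := by
      rw [Gam_coe, Gam_coe, h]; simp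
    exact Prod.mk.inj (hΓ e)
  have hy : Phi φ (discreteMeasure a₀ fun i => (X₀ i : Torus)) = ∑ i, a₀ i • ψ (X₀ i) :=
    Phi_discreteMeasure φ a₀ X₀
  set y : L2 := ∑ i, a₀ i • ψ (X₀ i) with hydef
  -- the branch of solutions of the optimality system
  obtain ⟨U, hU, hU0, u, hu0, husol, hureg⟩ := exists_implicitFunction
    (F := optimalitySystem ψ y s) (v₀ := (0 : ℝ × L2)) (u₀ := (a₀, X₀))
    (contDiff_optimalitySystem (n := 1) (by simpa [one_add_one_eq_two] using hψ) y s)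
    (by ext i <;> simp [optimalitySystem, spikeResidual, hydef])
    (fderiv_optimalitySystem_injective hψ ha₀ hΓ' s)
  have hUnhds : U ∈ 𝓝 (0 : ℝ × L2) := hU.mem_nhds hU0
  have hudiff : DifferentiableAt ℝ u 0 := ((hureg 1 (contDiff_optimalitySystem (n := 1)
    (by simpa [one_add_one_eq_two] using hψ) y s)).contDiffAt hUnhds).differentiableAt one_ne_zero
  have hucont : ContinuousAt u 0 := hudiff.continuousAt
  have hacont : ContinuousAt (fun v => (u v).1) 0 := hucont.fst
  have hXcont : ContinuousAt (fun v => (u v).2) 0 := hucont.snd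
  -- stability of the certificate
  obtain ⟨ρ, hρ, hcert⟩ := Metric.eventually_nhds_iff_ball.1
    (eventually_certificate hψ hper hs hoff' hX₀ hX₀'')
  have hsign : ∀ᶠ v in 𝓝 (0 : ℝ × L2), ∀ i, 0 < (u v).1 i * a₀ i := by
    refine eventually_all.2 fun i => ?_
    have h : 0 < (u 0).1 i * a₀ i := by
      rw [hu0]
      exact mul_self_pos.2 (ha₀ i)
    exact ((continuousAt_pi.1 hacont i).mul continuousAt_const).eventually (lt_mem_nhds h)
  have hinj : ∀ᶠ v in 𝓝 (0 : ℝ × L2), Function.Injective fun i => ((u v).2 i : Torus) := by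
    have h : ∀ᶠ v in 𝓝 (0 : ℝ × L2), ∀ i j, i ≠ j → ((u v).2 i : Torus) ≠ (u v).2 j := by
      refine eventually_all.2 fun i => eventually_all.2 fun j => ?_
      by_cases hij : i = j
      · simp [hij]
      · have hc : ∀ i, ContinuousAt (fun v => ((u v).2 i : Torus)) 0 := fun i =>
          ((AddCircle.continuous_mk' (1 : ℝ)).continuousAt.comp (continuousAt_pi.1 hXcont i))
        have hne : ((u 0).2 i : Torus) ≠ (u 0).2 j := by
          rw [hu0]; exact fun h => hij (hx₀ h)
        filter_upwards [((hc i).prodMk (hc j)).eventually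
          (isClosed_diagonal.isOpen_compl.mem_nhds hne)] with v hv _ using hv
    filter_upwards [h] with v hv i j hij
    by_contra hne
    exact hv i j hne hij
  -- Linear independence is an open condition; it makes the amplitudes recoverable from the
  -- measurement, as uniqueness requires.
  have hli : ∀ᶠ v in 𝓝 (0 : ℝ × L2), LinearIndependent ℝ fun i => ψ ((u v).2 i) := by
    have h0 : LinearIndependent ℝ fun i => ψ ((u 0).2 i) := by
      rw [hu0, Fintype.linearIndependent_iff]
      intro b hb
      exact congrFun (hΓ' b 0 (by simpa using hb)).1
    have hc : ContinuousAt (fun v i => ψ ((u v).2 i)) 0 := continuousAt_pi.2 fun i =>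
      hψ.continuous.continuousAt.comp (continuousAt_pi.1 hXcont i)
    exact hc.eventually h0.eventually
  have hXball : ∀ᶠ v in 𝓝 (0 : ℝ × L2), (u v).2 ∈ Metric.ball X₀ ρ := by
    refine hXcont.eventually (Metric.isOpen_ball.mem_nhds ?_)
    simp only [hu0, Metric.mem_ball_self hρ]
  have hres := eventually_norm_residual_add_le hψ hspan hX₀ hX₀' hudiff hu0
    (by filter_upwards [hUnhds] with v hv using husol v hv) (by positivity : 0 < ρ / 3)
  obtain ⟨C, hC, hbound⟩ := hudiff.hasFDerivAt.isBigO_sub.exists_pos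
  obtain ⟨δ, hδ, hall⟩ := Metric.eventually_nhds_iff_ball.1
    (hsign.and <| hinj.and <| hli.and <| hXball.and <| hres.and <| hbound.bound.and
      (Filter.eventually_mem_set.2 hUnhds))
  -- The dual variable will be within `α + ρ / 3 ≤ 2 * ρ / 3 < ρ` of `p₀`. The bound `α ≤ 1` makes
  -- the sup norm of `(lam, w)` at most `lam` on the domain.
  set α : ℝ := min 1 (ρ / 3) with hαdef
  have hα : 0 < α := lt_min one_pos (by positivity)
  have hα1 : α ≤ 1 := min_le_left _ _
  have hball : ∀ v ∈ smallNoise α (δ / 2), v ∈ Metric.ball (0 : ℝ × L2) δ := fun v hv => by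
    rw [mem_ball_zero_iff]
    linarith [norm_le_of_mem_smallNoise hα1 hv, hv.2.1]
  have hlinj : ∀ v ∈ smallNoise α (δ / 2), Function.Injective fun b =>
      Phi φ (discreteMeasure b fun i => ((u v).2 i : Torus)) := fun v hv => by
    have h := Fintype.linearIndependent_iff.1 (hall v (hball v hv)).2.2.1
    intro b c hbc
    simp only [Phi_discreteMeasure] at hbc
    refine funext fun i => sub_eq_zero.1 (h (b - c) ?_ i)
    simpa [sub_smul, sub_eq_zero] using hbc
  refine ⟨α, hα, δ / 2, by positivity, fun v => (u v).1, fun v i => ((u v).2 i : Torus),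
    ?_, ?_, ?_, ⟨U, hU, fun v hv => (hall v (hball v hv)).2.2.2.2.2.2, ?_⟩, C / α, ?_⟩
  · intro lam w hv
    obtain ⟨h_sign, h_inj, -, h_X, h_res, -, h_U⟩ := hall _ (hball _ hv)
    have hlin := hlinj _ hv
    have hsgn : ∀ i, SignType.sign ((u (lam, w)).1 i) = SignType.sign (a₀ i) := fun i => by
      rcases pos_and_pos_or_neg_and_neg_of_mul_pos (h_sign i) with ⟨h, h'⟩ | ⟨h, h'⟩ <;>
        simp [h, h']
    refine ⟨?_, h_inj, fun i => ⟨left_ne_zero_of_mul (h_sign i).ne', hsgn i⟩⟩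
    rw [hy]
    obtain ⟨hlam, -, hw⟩ := hv
    -- At `lam = 0` the domain forces `w = 0`, and `p₀` itself is the certificate.
    rcases hlam.eq_or_lt with h0 | hpos
    · obtain rfl : lam = 0 := h0.symm
      obtain rfl : w = 0 := norm_le_zero_iff.1 (by simpa using hw)
      rw [add_zero, ← hy]
      have e : u ((0 : ℝ), (0 : L2)) = (a₀, X₀) := hu0
      simp only [e] at hlin ⊢
      refine primalSolution_unique_zero hp₀.1.1 hoff (fun i => ?_) hlin
      rw [← inner_feature, hX₀, self_mul_sign]
    · change 0 < lam at hpos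
      set v : ℝ × L2 := (lam, w) with hvdef
      set R := spikeResidual ψ y (v, u v) with hRdef
      set p : L2 := -(lam⁻¹ • R) with hpdef
      have hsol := husol v h_U
      have hpX : ∀ i, inner ℝ (ψ ((u v).2 i)) p = s i := fun i => by
        have h : inner ℝ (ψ ((u v).2 i)) R + lam * s i = 0 :=
          congrFun (congrArg Prod.fst hsol) i
        rw [hpdef, inner_neg_right, inner_smul_right, eq_neg_of_add_eq_zero_left h]
        field_simp
      have hpX' : ∀ i, inner ℝ (deriv ψ ((u v).2 i)) p = 0 := fun i => by
        have h : inner ℝ (deriv ψ ((u v).2 i)) R = 0 := congrFun (congrArg Prod.snd hsol) i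
        rw [hpdef, inner_neg_right, inner_smul_right, h, mul_zero, neg_zero]
      have hpp₀ : dist p p₀ < ρ := by
        have e : p - p₀ = -(lam⁻¹ • (R + lam • p₀)) := by
          rw [smul_add, inv_smul_smul₀ hpos.ne', hpdef]; abel
        have hb : ‖R + lam • p₀‖ ≤ α * lam + ρ / 3 * lam := by
          refine h_res.trans (add_le_add hw ?_)
          gcongr
          rw [Prod.norm_def, Real.norm_of_nonneg hpos.le]
          exact max_le le_rfl (hw.trans (mul_le_of_le_one_left hpos.le hα1))
        rw [dist_eq_norm, e, norm_neg, norm_smul, norm_inv, Real.norm_of_nonneg hpos.le,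
          inv_mul_lt_iff₀ hpos]
        have h3 : α ≤ ρ / 3 := min_le_right _ _
        nlinarith
      have hcert' := hcert ((u v).2, p) (by rw [← ball_prod_same]; exact ⟨h_X, hpp₀⟩)
        fun i => ⟨hpX i, hpX' i⟩
      refine primalSolution_unique_pos (p := p) hpos ?_ (norm_PhiAdj_le_one hs hpX hcert')
        (fun t ht => ?_) (fun i => ?_) hlin
      · rw [Phi_discreteMeasure, hpdef, smul_neg, smul_inv_smul₀ hpos.ne', hRdef, spikeResidual]
        abel
      · obtain ⟨t, rfl⟩ := QuotientAddGroup.mk_surjective t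
        have := hcert' t fun i hi => ht ⟨i, hi.symm⟩
        rwa [inner_feature] at this
      · rw [← inner_feature, hpX, ← self_mul_sign, hsgn]
  · exact congrArg Prod.fst hu0
  · have e : u ((0 : ℝ), (0 : L2)) = (a₀, X₀) := hu0
    simp only [e]
  · intro k hk hkφ
    have hreg := hureg (k - 1 : ℕ) (contDiff_optimalitySystem (by
      have h := contDiff_feature hkφ
      -- Since `k ≥ 2`, the natural subtraction `k - 1` is a true one.
      obtain ⟨j, rfl⟩ : ∃ j, k = j + 1 := ⟨k - 1, by omega⟩
      simpa using h) y s)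
    exact ⟨contDiff_fst.comp_contDiffOn hreg, fun v hv =>
      ⟨fun v => (u v).2, contDiff_snd.comp_contDiffOn hreg v hv,
        Eventually.of_forall fun _ _ => rfl⟩⟩
  · intro w hw i
    have hmem : (‖w‖ / α, w) ∈ smallNoise α (δ / 2) :=
      ⟨by positivity, hw, (mul_div_cancel₀ _ hα.ne').ge⟩
    have hb := (hall _ (hball _ hmem)).2.2.2.2.2.1
    -- Differentiability of `u` at the origin bounds the error by `C * ‖v‖`, and here `‖v‖ ≤ ‖w‖ /
    -- α`.
    have hn : ‖u (‖w‖ / α, w) - (a₀, X₀)‖ ≤ C / α * ‖w‖ := by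
      rw [hu0, sub_zero] at hb
      refine hb.trans ?_
      rw [div_mul_eq_mul_div, mul_div_assoc]
      gcongr
      exact norm_le_of_mem_smallNoise hα1 hmem
    constructor
    · change ‖(((u (‖w‖ / α, w)).2 i - X₀ i : ℝ) : Torus)‖ ≤ _
      refine (QuotientAddGroup.norm_mk_le_norm.trans ?_).trans hn
      exact (norm_le_pi_norm ((u (‖w‖ / α, w)).2 - X₀) i).trans
        (norm_snd_le (u (‖w‖ / α, w) - (a₀, X₀)))
    · exact ((norm_le_pi_norm ((u (‖w‖ / α, w)).1 - a₀) i).trans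
        (norm_fst_le (u (‖w‖ / α, w) - (a₀, X₀)))).trans hn
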